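/- Let $\gamma_1\neq0$ and $\delta_1,\dots,\delta_{11}$ be complex constants and consider the autonomous third-order equation (of the kind that arises from generalized Darboux--Halphen/Euler three-particle systems) $$\gamma_1w'''+(\delta_1w+\delta_5)w''+\delta_2w'^2+(\delta_3w^2+\delta_6w+\delta_7)w'+\delta_4w^4+\delta_8w^3+\delta_9w^2+\delta_{10}w+\delta_{11}=0. \qquad (*)$$ Dividing by $\gamma_1$, write the conditions below for $\gamma_1=1$ (in general replace every $\delta_j$ by $\delta_j/\gamma_1$). For a lattice $\Lambda\subset\mathbb C$ with invariants $g_2,g_3$ let $\wp$ be its Weierstrass function. An elliptic function of order two is a meromorphic function on $\mathbb C$ whose set of periods is a lattice $\Lambda$ and which has two poles, counted with multiplicity, in a period parallelogram. **(a) Two simple poles.** A meromorphic function $w$ with period lattice $\Lambda$ is an elliptic solution of (*) of order two all of whose poles are simple if and only if, for some constants $c,h_0,A,B,t_0$, $$w(t)=-\frac{c\,(\wp'(t-t_0)+B)}{2(\wp(t-t_0)-A)}+h_0,$$ where $\delta_3\ne0$, $c^2=-6/\delta_3$, $h_0=-\frac{\delta_6}{2\delta_3}$, $A=\frac{4\delta_3\delta_7-\delta_6^2}{24\delta_3}$,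 $g_3=4A^3-g_2A-B^2$, $\delta_1=\frac{3\delta_4}{\delta_3}-\frac{\delta_2}{2}$, $\delta_5=\frac{12\delta_8\delta_3-18\delta_4\delta_6-\delta_2\delta_3\delta_6}{4\delta_3^2}$, $\delta_9=\frac{(4\delta_3\delta_7-\delta_6^2)\delta_2\delta_3+12(\delta_6\delta_8+2\delta_4\delta_7)\delta_3-18\delta_4\delta_6^2}{8\delta_3^2}$, and one of the following holds: 1. $\delta_2=\delta_4=\delta_8=\delta_{10}=\delta_{11}=0$ ($B,g_2$ arbitrary). 2. $\delta_2=\delta_4=0$, $\delta_8\neq0$, $\delta_{10}=\frac{3\delta_8\delta_7}{\delta_3}$, $B=c\,\frac{\delta_8\delta_6^3+4\delta_{11}\delta_3^3-2\delta_{10}\delta_6\delta_3^2}{144\delta_3\delta_8}$ ($g_2$ arbitrary). 3. $\delta_2=0$, $\delta_4\neq0$, $\delta_{11}=\frac{(2\delta_8\delta_3-3\delta_4\delta_6)(2\delta_{10}\delta_3^2-6\delta_8\delta_7\delta_3+9\delta_7\delta_6\delta_4)}{4\delta_3^3\delta_4}$, $B=c\,\frac{(4\delta_{10}\delta_3-12\delta_7\delta_8)\delta_3^2+(\delta_6^2+12\delta_7\delta_3)\delta_4\delta_6}{144\delta_3\delta_4}$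 ($g_2$ arbitrary). 4. $\delta_2\ne0$, $\delta_4=-\frac{\delta_2\delta_3}{2}$, $\delta_{10}=\frac{(2\delta_2\delta_6+3\delta_8)\delta_7}{\delta_3}$, $g_2=c\left[\left(\delta_6+\frac{\delta_8}{\delta_2}\right)B+c\,\frac{(6\delta_7\delta_3-\delta_6^2)\delta_8\delta_6-2(\delta_2\delta_7^2+2\delta_{11}\delta_3)\delta_3^2+(6\delta_7\delta_3-\delta_6^2)\delta_6^2\delta_2}{144\delta_2\delta_3}\right]$ ($B$ arbitrary). 5. $\delta_2\neq0$, $\delta_4\neq-\frac{\delta_2\delta_3}{2}$, $B=c\,\frac{(\delta_2\delta_3+2\delta_4)\delta_6^3-4(\delta_2\delta_3-6\delta_4)\delta_3\delta_6\delta_7+8(\delta_{10}\delta_3-3\delta_7\delta_8)\delta_3^2}{144(\delta_2\delta_3+2\delta_4)\delta_3}$, $g_2=\frac{(6\delta_4-\delta_2\delta_3)(18\delta_4+\delta_2\delta_3)\delta_7\delta_6^2+4(\mu_2\delta_3-\mu_1\delta_6)\delta_3}{48(\delta_2\delta_3+2\delta_4)\delta_3^2\delta_2}$, where $\mu_1=(\delta_2\delta_3-6\delta_4)\delta_3\delta_{10}+2(18\delta_4-\delta_2\delta_3)\delta_7\delta_8$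 and $\mu_2=(\delta_2\delta_3+2\delta_4)(2\delta_3\delta_{11}+\delta_2\delta_7^2)+4(3\delta_8\delta_7-\delta_3\delta_{10})\delta_8$. **(b) One double pole.** A meromorphic function $w$ with period lattice $\Lambda$ is an elliptic solution of (*) of order two having a double pole if and only if $w(t)=c\,\wp(t-t_0)+h_0$ for some constants $c,h_0,t_0$, where $\delta_3=\delta_4=0$, $\delta_6\neq0$, $c=-\frac{12}{\delta_6}$, $h_0=-\frac{\delta_7}{\delta_6}$, $\delta_8=\frac{\delta_6}{6}(2\delta_2+3\delta_1)$, $\delta_9=\frac12\delta_5\delta_6+(\delta_1+\delta_2)\delta_7$, and one of the following holds: 1. $\delta_2\neq0$, $\delta_1\neq-2\delta_2$, $g_2=\frac{\delta_7^2}{12}+\frac{(\delta_5\delta_7-\delta_{10})\delta_6}{6(\delta_1+2\delta_2)}$, $g_3=\frac{\delta_7^3}{216}+\frac{\delta_6^2\delta_{11}}{144\delta_2}+\frac{(\delta_5\delta_6+2\delta_2\delta_7)(\delta_5\delta_7-\delta_{10})\delta_6}{144(\delta_1+2\delta_2)\delta_2}$. 2. $\delta_2=0$, $\delta_1\neq0$,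 $\delta_{11}=\frac{(\delta_{10}-\delta_5\delta_7)\delta_5}{\delta_1}$, $g_2=\frac{\delta_7^2}{12}+\frac{(\delta_5\delta_7-\delta_{10})\delta_6}{6\delta_1}$ ($g_3$ arbitrary). 3. $\delta_1=-2\delta_2$, $\delta_2\neq0$, $\delta_{10}=\delta_5\delta_7$, $g_3=\frac1{12}\left(\delta_7+\frac{\delta_5\delta_6}{2\delta_2}\right)g_2-\frac{\delta_7^3}{432}+\frac{(2\delta_6\delta_{11}-\delta_5\delta_7^2)\delta_6}{288\delta_2}$ ($g_2$ arbitrary). 4. $\delta_1=\delta_2=0$, $\delta_{10}=\delta_5\delta_7$, $\delta_5\ne0$, $g_2=\frac{\delta_7^2}{12}-\frac{\delta_6\delta_{11}}{6\delta_5}$ ($g_3$ arbitrary). 5. $\delta_1=\delta_2=\delta_5=\delta_{10}=\delta_{11}=0$ ($g_2,g_3$ arbitrary). **(c) Existence.** Whenever constants satisfy the conditions of (a) or of (b) and $g_2^3-27g_3^2\neq0$, there is a lattice $\Lambda$ with invariants $g_2,g_3$, and for every $t_0\in\mathbb C$ the corresponding function is an elliptic solution of (*) of order two with period lattice $\Lambda$.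 -/

import Mathlib

open Filter

noncomputable section

/-- Constant complex coefficients of the autonomous third-order equation
`γ₁ w''' + (δ₁ w + δ₅) w'' + δ₂ w'² + (δ₃ w² + δ₆ w + δ₇) w' + δ₄ w⁴ + δ₈ w³ + δ₉ w² + δ₁₀ w + δ₁₁ = 0`. -/
structure DHCoeffs where
  γ₁ : ℂ
  δ₁ : ℂ
  δ₂ : ℂ
  δ₃ : ℂ
  δ₄ : ℂ
  δ₅ : ℂ
  δ₆ : ℂ
  δ₇ : ℂ
  δ₈ : ℂ
  δ₉ : ℂ
  δ₁₀ : ℂ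
  δ₁₁ : ℂ

namespace DHCoeffs

/-- The left-hand side of the equation, evaluated on `w` at the point `t`. -/
def lhs (p : DHCoeffs) (w : ℂ → ℂ) (t : ℂ) : ℂ :=
  p.γ₁ * iteratedDeriv 3 w t + (p.δ₁ * w t + p.δ₅) * iteratedDeriv 2 w t
    + p.δ₂ * deriv w t ^ 2 + (p.δ₃ * w t ^ 2 + p.δ₆ * w t + p.δ₇) * deriv w t
    + p.δ₄ * w t ^ 4 + p.δ₈ * w t ^ 3 + p.δ₉ * w t ^ 2 + p.δ₁₀ * w t + p.δ₁₁

/-- A function on `ℂ` (thought of as meromorphic) solves the equation if the equation holds at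
every point where the function is holomorphic. -/
def IsSolution (p : DHCoeffs) (w : ℂ → ℂ) : Prop :=
  ∀ t : ℂ, AnalyticAt ℂ w t → p.lhs w t = 0

/-- The coefficients of the equation divided by its leading coefficient. -/
def normalize (p : DHCoeffs) : DHCoeffs where
  γ₁ := 1
  δ₁ := p.δ₁ / p.γ₁
  δ₂ := p.δ₂ / p.γ₁
  δ₃ := p.δ₃ / p.γ₁
  δ₄ := p.δ₄ / p.γ₁
  δ₅ := p.δ₅ / p.γ₁
  δ₆ := p.δ₆ / p.γ₁
  δ₇ := p.δ₇ / p.γ₁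
  δ₈ := p.δ₈ / p.γ₁
  δ₉ := p.δ₉ / p.γ₁
  δ₁₀ := p.δ₁₀ / p.γ₁
  δ₁₁ := p.δ₁₁ / p.γ₁

end DHCoeffs

/-- The multiplicity of `z` as a pole of the meromorphic function `w` (`0` if `z` is no pole). -/
def poleMultiplicity (w : ℂ → ℂ) (z : ℂ) : ℕ :=
  (-(meromorphicOrderAt w z).untop₀).toNat

/-- `w` is an elliptic function of order `n` with period lattice `L`: it is meromorphic on `ℂ`, its
periods are exactly the elements of `L`, and it has `n` poles, counted with multiplicity, in the
half-open parallelogram spanned by the basis of `L`. The values of a meromorphic function on a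
closed discrete set are irrelevant, whence the identities of functions modulo `codiscrete ℂ`. -/
def IsEllipticOfOrder (L : PeriodPair) (n : ℕ) (w : ℂ → ℂ) : Prop :=
  Meromorphic w ∧
  (∀ l : ℂ, l ∈ L.lattice ↔ (fun z ↦ w (z + l)) =ᶠ[codiscrete ℂ] w) ∧
  ∑ᶠ z ∈ ZSpan.fundamentalDomain L.basis, poleMultiplicity w z = n

/-- The function `-c (℘'(t - t₀) + B) / (2 (℘(t - t₀) - A)) + h₀`. -/
def simplePoleForm (L : PeriodPair) (c h₀ A B t₀ : ℂ) (t : ℂ) : ℂ :=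
  -(c * (L.derivWeierstrassP (t - t₀) + B)) / (2 * (L.weierstrassP (t - t₀) - A)) + h₀

/-- The function `c ℘(t - t₀) + h₀`. -/
def doublePoleForm (L : PeriodPair) (c h₀ t₀ : ℂ) (t : ℂ) : ℂ :=
  c * L.weierstrassP (t - t₀) + h₀

/-! ### Families with two simple poles (for the equation with `γ₁ = 1`) -/

/-- Parameter values and restrictions shared by the five families with simple poles. The condition
`c ^ 2 = -6 / δ₃` says that `c = ε √(-6 / δ₃)` with `ε = ±1`. -/
def SimplePoleCommon (p : DHCoeffs) (c h₀ A B g₂ g₃ : ℂ) : Prop :=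
  p.δ₃ ≠ 0 ∧
  c ^ 2 = -6 / p.δ₃ ∧
  h₀ = -p.δ₆ / (2 * p.δ₃) ∧
  A = (4 * p.δ₃ * p.δ₇ - p.δ₆ ^ 2) / (24 * p.δ₃) ∧
  g₃ = 4 * A ^ 3 - g₂ * A - B ^ 2 ∧
  p.δ₁ = 3 * p.δ₄ / p.δ₃ - p.δ₂ / 2 ∧
  p.δ₅ = (12 * p.δ₈ * p.δ₃ - 18 * p.δ₄ * p.δ₆ - p.δ₂ * p.δ₃ * p.δ₆) / (4 * p.δ₃ ^ 2) ∧
  p.δ₉ = ((4 * p.δ₃ * p.δ₇ - p.δ₆ ^ 2) * p.δ₂ * p.δ₃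
      + 12 * (p.δ₆ * p.δ₈ + 2 * p.δ₄ * p.δ₇) * p.δ₃ - 18 * p.δ₄ * p.δ₆ ^ 2) / (8 * p.δ₃ ^ 2)

/-- First family: `B` and `g₂` are arbitrary. -/
def SimplePoleFamily₁ (p : DHCoeffs) : Prop :=
  p.δ₂ = 0 ∧ p.δ₄ = 0 ∧ p.δ₈ = 0 ∧ p.δ₁₀ = 0 ∧ p.δ₁₁ = 0

/-- Second family: `g₂` is arbitrary. -/
def SimplePoleFamily₂ (p : DHCoeffs) (c B : ℂ) : Prop :=
  p.δ₂ = 0 ∧ p.δ₄ = 0 ∧ p.δ₈ ≠ 0 ∧ p.δ₁₀ = 3 * p.δ₈ * p.δ₇ / p.δ₃ ∧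
  B = c * ((p.δ₈ * p.δ₆ ^ 3 + 4 * p.δ₁₁ * p.δ₃ ^ 3 - 2 * p.δ₁₀ * p.δ₆ * p.δ₃ ^ 2)
    / (144 * p.δ₃ * p.δ₈))

/-- Third family: `g₂` is arbitrary. -/
def SimplePoleFamily₃ (p : DHCoeffs) (c B : ℂ) : Prop :=
  p.δ₂ = 0 ∧ p.δ₄ ≠ 0 ∧
  p.δ₁₁ = (2 * p.δ₈ * p.δ₃ - 3 * p.δ₄ * p.δ₆)
    * (2 * p.δ₁₀ * p.δ₃ ^ 2 - 6 * p.δ₈ * p.δ₇ * p.δ₃ + 9 * p.δ₇ * p.δ₆ * p.δ₄)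
    / (4 * p.δ₃ ^ 3 * p.δ₄) ∧
  B = c * (((4 * p.δ₁₀ * p.δ₃ - 12 * p.δ₇ * p.δ₈) * p.δ₃ ^ 2
      + (p.δ₆ ^ 2 + 12 * p.δ₇ * p.δ₃) * p.δ₄ * p.δ₆) / (144 * p.δ₃ * p.δ₄))

/-- Fourth family: `B` is arbitrary. -/
def SimplePoleFamily₄ (p : DHCoeffs) (c B g₂ : ℂ) : Prop :=
  p.δ₂ ≠ 0 ∧ p.δ₄ = -(p.δ₂ * p.δ₃) / 2 ∧
  p.δ₁₀ = (2 * p.δ₂ * p.δ₆ + 3 * p.δ₈) * p.δ₇ / p.δ₃ ∧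
  g₂ = c * ((p.δ₆ + p.δ₈ / p.δ₂) * B
    + c * (((6 * p.δ₇ * p.δ₃ - p.δ₆ ^ 2) * p.δ₈ * p.δ₆
      - 2 * (p.δ₂ * p.δ₇ ^ 2 + 2 * p.δ₁₁ * p.δ₃) * p.δ₃ ^ 2
      + (6 * p.δ₇ * p.δ₃ - p.δ₆ ^ 2) * p.δ₆ ^ 2 * p.δ₂) / (144 * p.δ₂ * p.δ₃)))

/-- Auxiliary constant `μ₁` of the fifth family. -/
def DHCoeffs.μ₁ (p : DHCoeffs) : ℂ :=
  (p.δ₂ * p.δ₃ - 6 * p.δ₄) * p.δ₃ * p.δ₁₀ + 2 * (18 * p.δ₄ - p.δ₂ * p.δ₃) * p.δ₇ * p.δ₈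

/-- Auxiliary constant `μ₂` of the fifth family. -/
def DHCoeffs.μ₂ (p : DHCoeffs) : ℂ :=
  (p.δ₂ * p.δ₃ + 2 * p.δ₄) * (2 * p.δ₃ * p.δ₁₁ + p.δ₂ * p.δ₇ ^ 2)
    + 4 * (3 * p.δ₈ * p.δ₇ - p.δ₃ * p.δ₁₀) * p.δ₈

/-- Fifth family: `B` and `g₂` are determined. -/
def SimplePoleFamily₅ (p : DHCoeffs) (c B g₂ : ℂ) : Prop :=
  p.δ₂ ≠ 0 ∧ p.δ₄ ≠ -(p.δ₂ * p.δ₃) / 2 ∧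
  B = c * (((p.δ₂ * p.δ₃ + 2 * p.δ₄) * p.δ₆ ^ 3
      - 4 * (p.δ₂ * p.δ₃ - 6 * p.δ₄) * p.δ₃ * p.δ₆ * p.δ₇
      + 8 * (p.δ₁₀ * p.δ₃ - 3 * p.δ₇ * p.δ₈) * p.δ₃ ^ 2)
    / (144 * (p.δ₂ * p.δ₃ + 2 * p.δ₄) * p.δ₃)) ∧
  g₂ = ((6 * p.δ₄ - p.δ₂ * p.δ₃) * (18 * p.δ₄ + p.δ₂ * p.δ₃) * p.δ₇ * p.δ₆ ^ 2
      + 4 * (p.μ₂ * p.δ₃ - p.μ₁ * p.δ₆) * p.δ₃)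
    / (48 * (p.δ₂ * p.δ₃ + 2 * p.δ₄) * p.δ₃ ^ 2 * p.δ₂)

/-- The parameters belong to one of the five families with two simple poles. -/
def SimplePoleParams (p : DHCoeffs) (c h₀ A B g₂ g₃ : ℂ) : Prop :=
  SimplePoleCommon p c h₀ A B g₂ g₃ ∧
  (SimplePoleFamily₁ p ∨ SimplePoleFamily₂ p c B ∨ SimplePoleFamily₃ p c B ∨
    SimplePoleFamily₄ p c B g₂ ∨ SimplePoleFamily₅ p c B g₂)

/-! ### Families with one double pole (for the equation with `γ₁ = 1`) -/

/-- Parameter values and restrictions shared by the families with a double pole. -/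
def DoublePoleCommon (p : DHCoeffs) (c h₀ : ℂ) : Prop :=
  p.δ₃ = 0 ∧ p.δ₄ = 0 ∧ p.δ₆ ≠ 0 ∧
  c = -12 / p.δ₆ ∧
  h₀ = -p.δ₇ / p.δ₆ ∧
  p.δ₈ = p.δ₆ / 6 * (2 * p.δ₂ + 3 * p.δ₁) ∧
  p.δ₉ = p.δ₅ * p.δ₆ / 2 + (p.δ₁ + p.δ₂) * p.δ₇

/-- First family: `g₂` and `g₃` are determined. -/
def DoublePoleFamily₁ (p : DHCoeffs) (g₂ g₃ : ℂ) : Prop :=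
  p.δ₂ ≠ 0 ∧ p.δ₁ ≠ -2 * p.δ₂ ∧
  g₂ = p.δ₇ ^ 2 / 12 + (p.δ₅ * p.δ₇ - p.δ₁₀) * p.δ₆ / (6 * (p.δ₁ + 2 * p.δ₂)) ∧
  g₃ = p.δ₇ ^ 3 / 216 + p.δ₆ ^ 2 * p.δ₁₁ / (144 * p.δ₂)
    + (p.δ₅ * p.δ₆ + 2 * p.δ₂ * p.δ₇) * (p.δ₅ * p.δ₇ - p.δ₁₀) * p.δ₆
      / (144 * (p.δ₁ + 2 * p.δ₂) * p.δ₂)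

/-- Second family: `g₃` is arbitrary. -/
def DoublePoleFamily₂ (p : DHCoeffs) (g₂ : ℂ) : Prop :=
  p.δ₂ = 0 ∧ p.δ₁ ≠ 0 ∧ p.δ₁₁ = (p.δ₁₀ - p.δ₅ * p.δ₇) * p.δ₅ / p.δ₁ ∧
  g₂ = p.δ₇ ^ 2 / 12 + (p.δ₅ * p.δ₇ - p.δ₁₀) * p.δ₆ / (6 * p.δ₁)

/-- Third family: `g₂` is arbitrary. -/
def DoublePoleFamily₃ (p : DHCoeffs) (g₂ g₃ : ℂ) : Prop :=
  p.δ₁ = -2 * p.δ₂ ∧ p.δ₂ ≠ 0 ∧ p.δ₁₀ = p.δ₅ * p.δ₇ ∧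
  g₃ = (p.δ₇ + p.δ₅ * p.δ₆ / (2 * p.δ₂)) * g₂ / 12 - p.δ₇ ^ 3 / 432
    + (2 * p.δ₆ * p.δ₁₁ - p.δ₅ * p.δ₇ ^ 2) * p.δ₆ / (288 * p.δ₂)

/-- Fourth family: `g₃` is arbitrary. -/
def DoublePoleFamily₄ (p : DHCoeffs) (g₂ : ℂ) : Prop :=
  p.δ₁ = 0 ∧ p.δ₂ = 0 ∧ p.δ₁₀ = p.δ₅ * p.δ₇ ∧ p.δ₅ ≠ 0 ∧
  g₂ = p.δ₇ ^ 2 / 12 - p.δ₆ * p.δ₁₁ / (6 * p.δ₅)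

/-- Fifth family: `g₂` and `g₃` are arbitrary. -/
def DoublePoleFamily₅ (p : DHCoeffs) : Prop :=
  p.δ₁ = 0 ∧ p.δ₂ = 0 ∧ p.δ₅ = 0 ∧ p.δ₁₀ = 0 ∧ p.δ₁₁ = 0

/-- The parameters belong to one of the families with a double pole. -/
def DoublePoleParams (p : DHCoeffs) (c h₀ g₂ g₃ : ℂ) : Prop :=
  DoublePoleCommon p c h₀ ∧
  (DoublePoleFamily₁ p g₂ g₃ ∨ DoublePoleFamily₂ p g₂ ∨ DoublePoleFamily₃ p g₂ g₃ ∨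
    DoublePoleFamily₄ p g₂ ∨ DoublePoleFamily₅ p)

end

noncomputable section

open Topology

/-! ### Identities modulo closed discrete sets -/

/-! The proof first finds all elliptic functions of order two on a given lattice and then
substitutes them into the equation. Since values at poles carry no information, functions are
compared modulo closed discrete sets.

Normal forms. The key fact is that an elliptic function with at most one simple pole modulo the
lattice is constant (`IsElliptic.exists_const_of_simple_pole`). It is proved without contour
integrals. Otherwise the odd part `F` would have a simple pole at `0`, so `F²` and `F'` would both
be affine in `℘`. Eliminating `F` would then give the Weierstrass cubic a repeated root, whereas the
three half periods give three distinct roots. Subtracting leading terms now shows that a function of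
order two is affine in `℘` (double pole) or in `φ = (℘' + B) / (2 (℘ - A))` with `(A, B) = (℘ u, ℘'
u)` (simple poles differing by `u`). That is why `(A, B)` lies on the cubic, which gives the formula
for `g₃`.

Reduction to algebra. With `R = X⁴ - 6A X² - 4B X + g₂ - 3A²` one has `φ'² = R(φ)`, `φ'' = 2φ³ - 6Aφ
- 2B` and `φ''' = (6φ² - 6A) φ'`, so the equation becomes `P(φ) + Q(φ) φ' = 0`. Hence `P² = Q² R`,
and as `R` is not a square, `P = Q = 0`. For `℘` the corresponding `P(℘) + Q(℘) ℘' = 0` splits by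
parity. The coefficients of `P` and `Q` form a triangular system (`simplePoleEquations_iff`,
`doublePoleEquations_iff`). All but two equations give the common conditions. The last two are
linear in the remaining parameters, and the five families record which leading coefficients vanish.

Existence. `E₄³ / Δ` takes every value: if `E₄³ - jΔ` had no zero, `Δ / (E₄³ - jΔ)` would be a
nonvanishing modular form of weight zero tending to `0` at the cusp. Choosing `j` from `g₂, g₃` and
rescaling the lattice realises every nonsingular cubic (`PeriodPair.exists_g₂_eq_g₃_eq`).
Surjectivity of `℘` then writes any point `(A, B)` of the cubic as `(℘ u, ℘' u)`. -/

lemma eventually_codiscrete_iff_nhdsNE {p : ℂ → Prop} :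
    (∀ᶠ z in codiscrete ℂ, p z) ↔ ∀ z, ∀ᶠ w in 𝓝[≠] z, p w := by
  simp only [Filter.Eventually, codiscrete, mem_codiscreteWithin_iff_forall_mem_nhdsNE,
    Set.compl_univ, Set.union_empty, Set.mem_univ, forall_const]

lemma eventuallyEq_codiscrete_iff_nhdsNE {f g : ℂ → ℂ} :
    f =ᶠ[codiscrete ℂ] g ↔ ∀ z, f =ᶠ[𝓝[≠] z] g :=
  eventually_codiscrete_iff_nhdsNE

lemma tendsto_nhdsNE_of_injective {f : ℂ → ℂ} (hf : Continuous f) (hi : Function.Injective f)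
    (z : ℂ) : Tendsto f (𝓝[≠] z) (𝓝[≠] (f z)) :=
  hf.continuousWithinAt.tendsto_nhdsWithin fun _ hw ↦ hi.ne hw

lemma tendsto_codiscrete_of_injective {f : ℂ → ℂ} (hf : Continuous f)
    (hi : Function.Injective f) : Tendsto f (codiscrete ℂ) (codiscrete ℂ) := fun s hs ↦ by
  have hs' : ∀ᶠ z in codiscrete ℂ, z ∈ s := hs
  change ∀ᶠ z in codiscrete ℂ, f z ∈ s
  rw [eventually_codiscrete_iff_nhdsNE] at hs' ⊢
  exact fun z ↦ (tendsto_nhdsNE_of_injective hf hi z).eventually (hs' (f z))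

lemma tendsto_add_const_codiscrete (a : ℂ) :
    Tendsto (fun z ↦ z + a) (codiscrete ℂ) (codiscrete ℂ) :=
  tendsto_codiscrete_of_injective (by fun_prop) (add_left_injective a)

lemma tendsto_sub_const_codiscrete (a : ℂ) :
    Tendsto (fun z ↦ z - a) (codiscrete ℂ) (codiscrete ℂ) :=
  tendsto_codiscrete_of_injective (by fun_prop) sub_left_injective

lemma tendsto_neg_codiscrete : Tendsto (fun z : ℂ ↦ -z) (codiscrete ℂ) (codiscrete ℂ) :=
  tendsto_codiscrete_of_injective (by fun_prop) neg_injective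

lemma codiscrete_neBot : NeBot (codiscrete ℂ) :=
  ⟨fun h ↦ by
    have : ∀ᶠ z in codiscrete ℂ, False := by simp [h]
    exact ((eventually_codiscrete_iff_nhdsNE.1 this) 0).exists.elim fun _ h ↦ h⟩

lemma deriv_eventuallyEq_codiscrete {f g : ℂ → ℂ} (h : f =ᶠ[codiscrete ℂ] g) :
    deriv f =ᶠ[codiscrete ℂ] deriv g := by
  rw [eventuallyEq_codiscrete_iff_nhdsNE] at h ⊢
  exact fun z ↦ (h z).nhdsNE_deriv

lemma eventually_codiscrete_analyticAt {f : ℂ → ℂ} (hf : Meromorphic f) :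
    ∀ᶠ z in codiscrete ℂ, AnalyticAt ℂ f z :=
  (hf.meromorphicOn (s := Set.univ)).analyticAt_mem_codiscreteWithin

/-- Equality modulo a closed discrete set upgrades to equality of germs at almost every point. -/
lemma eventually_codiscrete_eventuallyEq_nhds {f g : ℂ → ℂ} (h : f =ᶠ[codiscrete ℂ] g) :
    ∀ᶠ z in codiscrete ℂ, f =ᶠ[𝓝 z] g := by
  rw [eventuallyEq_codiscrete_iff_nhdsNE] at h
  rw [eventually_codiscrete_iff_nhdsNE]
  intro z
  obtain ⟨u, hu, hz, hfg⟩ := eventually_nhds_iff.1 (eventually_nhdsWithin_iff.1 (h z)) |>.imp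
    fun u h ↦ And.intro h.2.1 (And.intro h.2.2 h.1)
  filter_upwards [mem_nhdsWithin_of_mem_nhds (hu.mem_nhds hz), self_mem_nhdsWithin] with w hw hwz
  filter_upwards [hu.mem_nhds hw, isOpen_compl_singleton.mem_nhds hwz] with v hv hvz
  exact hfg v hv hvz

lemma meromorphicOrderAt_congr_codiscrete {f g : ℂ → ℂ} (h : f =ᶠ[codiscrete ℂ] g) (z : ℂ) :
    meromorphicOrderAt f z = meromorphicOrderAt g z :=
  meromorphicOrderAt_congr (eventuallyEq_codiscrete_iff_nhdsNE.1 h z)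

lemma poleMultiplicity_congr {f g : ℂ → ℂ} (h : f =ᶠ[codiscrete ℂ] g) (z : ℂ) :
    poleMultiplicity f z = poleMultiplicity g z := by
  rw [poleMultiplicity, poleMultiplicity, meromorphicOrderAt_congr_codiscrete h]

lemma meromorphicOrderAt_comp_add_const (f : ℂ → ℂ) (a z : ℂ) :
    meromorphicOrderAt (fun w ↦ f (w + a)) z = meromorphicOrderAt f (z + a) :=
  meromorphicOrderAt_comp_add_const_eq_meromorphicOrderAt

lemma meromorphicOrderAt_comp_sub_const (f : ℂ → ℂ) (a z : ℂ) :
    meromorphicOrderAt (fun w ↦ f (w - a)) z = meromorphicOrderAt f (z - a) :=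
  meromorphicOrderAt_comp_sub_const_eq_meromorphicOrderAt

lemma meromorphicOrderAt_comp_neg (f : ℂ → ℂ) (z : ℂ) :
    meromorphicOrderAt (fun w ↦ f (-w)) z = meromorphicOrderAt f (-z) :=
  meromorphicOrderAt_comp_of_deriv_ne_zero (f := f) (g := fun w ↦ -w) (by fun_prop) (by simp)

lemma Meromorphic.comp_neg {f : ℂ → ℂ} (hf : Meromorphic f) : Meromorphic fun z ↦ f (-z) :=
  fun z ↦ (hf (-z)).comp_analyticAt (g := fun w ↦ -w) (by fun_prop)

/-! ### Elliptic functions and Liouville's theorem -/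

/-- Meromorphic functions on the plane whose periods include the lattice of `L`. -/
structure PeriodPair.IsElliptic (L : PeriodPair) (f : ℂ → ℂ) : Prop where
  meromorphic : Meromorphic f
  periodic : ∀ l ∈ L.lattice, (fun z ↦ f (z + l)) =ᶠ[codiscrete ℂ] f

namespace PeriodPair.IsElliptic

variable {L : PeriodPair} {f g : ℂ → ℂ}

lemma congr (hf : L.IsElliptic f) (h : f =ᶠ[codiscrete ℂ] g) : L.IsElliptic g where
  meromorphic := hf.meromorphic.congr_codiscrete h
  periodic l hl := by
    filter_upwards [(tendsto_add_const_codiscrete l).eventually h, hf.periodic l hl, h]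
      with z h1 h2 h3
    rw [← h1, h2, h3]

lemma const (c : ℂ) : L.IsElliptic fun _ ↦ c := ⟨.const c, fun _ _ ↦ .rfl⟩

lemma add (hf : L.IsElliptic f) (hg : L.IsElliptic g) : L.IsElliptic fun z ↦ f z + g z :=
  ⟨hf.meromorphic.add hg.meromorphic, fun l hl ↦ (hf.periodic l hl).add (hg.periodic l hl)⟩

lemma sub (hf : L.IsElliptic f) (hg : L.IsElliptic g) : L.IsElliptic fun z ↦ f z - g z :=
  ⟨hf.meromorphic.sub hg.meromorphic, fun l hl ↦ (hf.periodic l hl).sub (hg.periodic l hl)⟩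

lemma mul (hf : L.IsElliptic f) (hg : L.IsElliptic g) : L.IsElliptic fun z ↦ f z * g z :=
  ⟨hf.meromorphic.mul hg.meromorphic, fun l hl ↦ (hf.periodic l hl).mul (hg.periodic l hl)⟩

lemma inv (hf : L.IsElliptic f) : L.IsElliptic fun z ↦ (f z)⁻¹ :=
  ⟨hf.meromorphic.inv, fun l hl ↦ (hf.periodic l hl).inv⟩

lemma div (hf : L.IsElliptic f) (hg : L.IsElliptic g) : L.IsElliptic fun z ↦ f z / g z :=
  ⟨hf.meromorphic.div hg.meromorphic, fun l hl ↦ (hf.periodic l hl).div (hg.periodic l hl)⟩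

lemma pow (hf : L.IsElliptic f) (n : ℕ) : L.IsElliptic fun z ↦ f z ^ n :=
  ⟨hf.meromorphic.pow, fun l hl ↦ (hf.periodic l hl).pow_const n⟩

lemma const_mul (hf : L.IsElliptic f) (c : ℂ) : L.IsElliptic fun z ↦ c * f z :=
  (const c).mul hf

lemma deriv (hf : L.IsElliptic f) : L.IsElliptic (deriv f) where
  meromorphic := hf.meromorphic.deriv
  periodic l hl := by
    have := deriv_eventuallyEq_codiscrete (hf.periodic l hl)
    refine EventuallyEq.trans (.of_eq ?_) this
    ext z
    rw [deriv_comp_add_const]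

lemma comp_neg (hf : L.IsElliptic f) : L.IsElliptic fun z ↦ f (-z) where
  meromorphic := hf.meromorphic.comp_neg
  periodic l hl := by
    filter_upwards [tendsto_neg_codiscrete.eventually (hf.periodic (-l) (neg_mem hl))] with z hz
    rw [← hz, neg_add]

lemma comp_sub_const (hf : L.IsElliptic f) (a : ℂ) : L.IsElliptic fun z ↦ f (z - a) where
  meromorphic := Meromorphic.meromorphic_fun_comp_sub_const_iff_meromorphic.2 hf.meromorphic
  periodic l hl := by
    filter_upwards [(tendsto_sub_const_codiscrete a).eventually (hf.periodic l hl)] with z hz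
    rw [← hz]; ring_nf

lemma comp_add_const (hf : L.IsElliptic f) (a : ℂ) : L.IsElliptic fun z ↦ f (z + a) := by
  simpa using hf.comp_sub_const (-a)

lemma order_add_of_mem (hf : L.IsElliptic f) {l : ℂ} (hl : l ∈ L.lattice) (z : ℂ) :
    meromorphicOrderAt f (z + l) = meromorphicOrderAt f z := by
  rw [← meromorphicOrderAt_comp_add_const f l z,
    meromorphicOrderAt_congr_codiscrete (hf.periodic l hl)]

/-- Liouville's theorem: an elliptic function without poles is constant. -/
theorem exists_const (hf : L.IsElliptic f) (h : ∀ z, 0 ≤ meromorphicOrderAt f z) :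
    ∃ c, f =ᶠ[codiscrete ℂ] fun _ ↦ c := by
  have hm : MeromorphicOn f Set.univ := hf.meromorphic.meromorphicOn
  -- The normal form discards the arbitrary values of `f` on a discrete set, so nonnegative order
  -- becomes analyticity at every point and `g` is entire.
  set g := toMeromorphicNFOn f Set.univ with hg
  have hfg : f =ᶠ[codiscrete ℂ] g := toMeromorphicNFOn_eqOn_codiscrete hm
  have hgan : ∀ z, AnalyticAt ℂ g z := fun z ↦ by
    have hnf := meromorphicNFOn_toMeromorphicNFOn f Set.univ (Set.mem_univ z)
    rw [← hnf.meromorphicOrderAt_nonneg_iff_analyticAt,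
      meromorphicOrderAt_toMeromorphicNFOn hm (Set.mem_univ z)]
    exact h z
  have hgd : Differentiable ℂ g := fun z ↦ (hgan z).differentiableAt
  -- By continuity, periodicity almost everywhere becomes periodicity everywhere; the range of `g`
  -- is then compact.
  have hper : ∀ z, ∀ l ∈ L.lattice, g (z + l) = g z := fun z l hl ↦ by
    have h1 := (hf.congr hfg).periodic l hl
    have h2 : (fun z ↦ g (z + l)) =ᶠ[𝓝[≠] z] g := eventuallyEq_codiscrete_iff_nhdsNE.1 h1 z
    have h3 := ((hgan z).continuousAt.tendsto).mono_left (nhdsWithin_le_nhds (s := {z}ᶜ))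
    have h4 : Tendsto (fun z ↦ g (z + l)) (𝓝[≠] z) (𝓝 (g (z + l))) :=
      ((hgd.continuous.comp (continuous_add_const l)).tendsto z).mono_left nhdsWithin_le_nhds
    exact tendsto_nhds_unique (h4.congr' h2) h3
  refine ⟨g 0, hfg.trans (.of_eq (funext fun z ↦ ?_))⟩
  exact hgd.apply_eq_apply_of_bounded
    (IsZLattice.isCompact_range_of_periodic L.lattice _ hgd.continuous
      fun z w hw ↦ hper z w hw).isBounded z 0

end PeriodPair.IsElliptic

/-- A solution of a second order linear equation with vanishing initial data vanishes. -/
lemma eventually_eq_zero_of_deriv_deriv_eq_mul {d g : ℂ → ℂ} {z : ℂ} (hd : AnalyticAt ℂ d z)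
    (hg : AnalyticAt ℂ g z) (h : deriv (deriv d) =ᶠ[𝓝 z] fun w ↦ g w * d w) (h0 : d z = 0)
    (h1 : deriv d z = 0) : ∀ᶠ w in 𝓝 z, d w = 0 := by
  rw [← analyticOrderAt_eq_top]
  -- Two derivatives lower a finite order of vanishing by two, while multiplication by `g` cannot
  -- lower it.
  have e1 : analyticOrderAt (deriv d) z + 1 = analyticOrderAt d z := by
    simpa [h0] using hd.analyticOrderAt_deriv_add_one
  have e2 : analyticOrderAt (deriv (deriv d)) z + 1 = analyticOrderAt (deriv d) z := by
    simpa [h1] using hd.deriv.analyticOrderAt_deriv_add_one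
  have e3 : analyticOrderAt (deriv (deriv d)) z = analyticOrderAt g z + analyticOrderAt d z := by
    rw [analyticOrderAt_congr h]; exact analyticOrderAt_mul hg hd
  by_contra hne
  lift analyticOrderAt d z to ℕ using hne with n hn
  rw [← e2, e3] at e1
  cases hgo : analyticOrderAt g z with
  | top => rw [hgo] at e1; simp at e1
  | coe m =>
    rw [hgo] at e1
    norm_cast at e1
    omega

/-- Identity theorem: meromorphic functions which agree near a point agree almost everywhere. -/
lemma eventuallyEq_codiscrete_of_eventuallyEq_nhdsNE {f g : ℂ → ℂ} (hf : Meromorphic f)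
    (hg : Meromorphic g) {z : ℂ} (h : f =ᶠ[𝓝[≠] z] g) : f =ᶠ[codiscrete ℂ] g := by
  rw [eventuallyEq_codiscrete_iff_nhdsNE]
  intro w
  have hm : MeromorphicOn (f - g) Set.univ := (hf.sub hg).meromorphicOn
  have hz : meromorphicOrderAt (f - g) z = ⊤ := by
    rw [meromorphicOrderAt_eq_top_iff]
    filter_upwards [h] with v hv using by simp [hv]
  have hw : meromorphicOrderAt (f - g) w = ⊤ := by
    by_contra hne
    exact hm.meromorphicOrderAt_ne_top_of_isPreconnected isPreconnected_univ
      (Set.mem_univ w) (Set.mem_univ z) hne hz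
  filter_upwards [meromorphicOrderAt_eq_top_iff.1 hw] with v hv using sub_eq_zero.1 hv

lemma meromorphicOrderAt_ne_top_of_ne_top {f : ℂ → ℂ} (hf : Meromorphic f) {z : ℂ}
    (h : meromorphicOrderAt f z ≠ ⊤) (w : ℂ) : meromorphicOrderAt f w ≠ ⊤ :=
  (hf.meromorphicOn (s := Set.univ)).meromorphicOrderAt_ne_top_of_isPreconnected
    isPreconnected_univ (Set.mem_univ z) (Set.mem_univ w) h

lemma eventually_codiscrete_ne_zero {f : ℂ → ℂ} (hf : Meromorphic f) {z : ℂ}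
    (h : meromorphicOrderAt f z ≠ ⊤) : ∀ᶠ w in codiscrete ℂ, f w ≠ 0 :=
  (hf.meromorphicOn (s := Set.univ)).eventually_codiscreteWithin_apply_ne_zero
    fun w _ ↦ meromorphicOrderAt_ne_top_of_ne_top hf h w

lemma meromorphicOrderAt_add_of_nonneg {f g : ℂ → ℂ} {z : ℂ} (hg : MeromorphicAt g z)
    (h : meromorphicOrderAt f z < 0) (h' : 0 ≤ meromorphicOrderAt g z) :
    meromorphicOrderAt (fun w ↦ f w + g w) z = meromorphicOrderAt f z :=
  meromorphicOrderAt_add_eq_left_of_lt (f₁ := f) hg (h.trans_le h')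

lemma meromorphicOrderAt_sub_const {f : ℂ → ℂ} {z : ℂ} (h : meromorphicOrderAt f z < 0) (c : ℂ) :
    meromorphicOrderAt (fun w ↦ f w - c) z = meromorphicOrderAt f z := by
  simpa only [sub_eq_add_neg] using meromorphicOrderAt_add_of_nonneg (g := fun _ ↦ -c) (.const _ _)
    h (AnalyticAt.meromorphicOrderAt_nonneg (by fun_prop))

/-- An elliptic function with a pole is almost everywhere different from a given value. -/
lemma eventually_codiscrete_sub_const_ne_zero {f : ℂ → ℂ} (hf : Meromorphic f) {z : ℂ}
    (h : meromorphicOrderAt f z < 0) (c : ℂ) : ∀ᶠ w in codiscrete ℂ, f w ≠ c := by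
  filter_upwards [eventually_codiscrete_ne_zero (hf.sub (.const c)) (z := z)
    ((meromorphicOrderAt_sub_const h c).trans_lt h).ne_top] with w hw using
      fun h ↦ hw (by simp [h])

/-! ### The Weierstrass function: differential equations, periods, values, half periods -/

namespace PeriodPair

variable (L : PeriodPair)

lemma isElliptic_weierstrassP : L.IsElliptic L.weierstrassP where
  meromorphic := L.meromorphic_weierstrassP
  periodic l hl := .of_eq (funext fun z ↦ L.weierstrassP_add_coe z ⟨l, hl⟩)

lemma isElliptic_derivWeierstrassP : L.IsElliptic L.derivWeierstrassP where
  meromorphic := L.meromorphic_derivWeierstrassP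
  periodic l hl := .of_eq (funext fun z ↦ L.derivWeierstrassP_add_coe z ⟨l, hl⟩)

lemma eventually_notMem_lattice : ∀ᶠ z in codiscrete ℂ, z ∉ L.lattice := by
  rw [eventually_codiscrete_iff_nhdsNE]
  intro z
  filter_upwards [mem_nhdsWithin_of_mem_nhds (L.compl_lattice_sdiff_singleton_mem_nhds z),
    self_mem_nhdsWithin] with w hw hwz hwL
  exact hw ⟨hwL, hwz⟩

lemma eventually_nhds_notMem_lattice {z : ℂ} (hz : z ∉ L.lattice) :
    ∀ᶠ w in 𝓝 z, w ∉ L.lattice :=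
  L.isClosed_lattice.isOpen_compl.mem_nhds hz

lemma analyticAt_weierstrassP {z : ℂ} (hz : z ∉ L.lattice) : AnalyticAt ℂ L.weierstrassP z :=
  L.analyticOnNhd_weierstrassP z hz

lemma analyticAt_derivWeierstrassP {z : ℂ} (hz : z ∉ L.lattice) :
    AnalyticAt ℂ L.derivWeierstrassP z :=
  L.analyticOnNhd_derivWeierstrassP z hz

lemma order_derivWeierstrassP (l : ℂ) (hl : l ∈ L.lattice) :
    meromorphicOrderAt L.derivWeierstrassP l = -3 := by
  rw [← L.deriv_weierstrassP]
  exact meromorphicOrderAt_deriv_eq_sub_one (n := -2) (by norm_num) (L.order_weierstrassP l hl)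

lemma order_weierstrassP_neg_iff {z : ℂ} :
    meromorphicOrderAt L.weierstrassP z < 0 ↔ z ∈ L.lattice := by
  refine ⟨fun h ↦ ?_, fun h ↦ by rw [L.order_weierstrassP z h]; decide⟩
  by_contra hz
  exact h.not_ge (L.analyticAt_weierstrassP hz).meromorphicOrderAt_nonneg

lemma order_weierstrassP_ne_top (z : ℂ) : meromorphicOrderAt L.weierstrassP z ≠ ⊤ :=
  meromorphicOrderAt_ne_top_of_ne_top L.meromorphic_weierstrassP
    (z := 0) (by rw [L.order_weierstrassP 0 (zero_mem _)]; decide) z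

lemma eventually_weierstrassP_ne (a : ℂ) : ∀ᶠ z in codiscrete ℂ, L.weierstrassP z ≠ a :=
  eventually_codiscrete_sub_const_ne_zero L.meromorphic_weierstrassP
    (L.order_weierstrassP_neg_iff.2 (zero_mem _)) a

lemma eventually_derivWeierstrassP_ne (a : ℂ) :
    ∀ᶠ z in codiscrete ℂ, L.derivWeierstrassP z ≠ a :=
  eventually_codiscrete_sub_const_ne_zero L.meromorphic_derivWeierstrassP
    (by rw [L.order_derivWeierstrassP 0 (zero_mem _)]; decide) a

lemma hasDerivAt_weierstrassP {z : ℂ} (hz : z ∉ L.lattice) :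
    HasDerivAt L.weierstrassP (L.derivWeierstrassP z) z := by
  rw [← L.deriv_weierstrassP]
  exact (L.analyticAt_weierstrassP hz).differentiableAt.hasDerivAt

/-- The second order differential equation of the Weierstrass function. -/
lemma deriv_derivWeierstrassP {z : ℂ} (hz : z ∉ L.lattice) :
    deriv L.derivWeierstrassP z = 6 * L.weierstrassP z ^ 2 - L.g₂ / 2 := by
  -- Differentiating the cubic relation gives the claim multiplied by `2 ℘'`. It can be cancelled
  -- off the zeros of `℘'`, and continuity covers those.
  have key : ∀ w, w ∉ L.lattice → L.derivWeierstrassP w ≠ 0 →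
      deriv L.derivWeierstrassP w = 6 * L.weierstrassP w ^ 2 - L.g₂ / 2 := fun w hw hw0 ↦ by
    have h1 := ((L.analyticAt_derivWeierstrassP hw).differentiableAt.hasDerivAt).pow 2
    have h2 := ((((L.hasDerivAt_weierstrassP hw).pow 3).const_mul 4).sub
      ((L.hasDerivAt_weierstrassP hw).const_mul L.g₂)).sub_const L.g₃
    have h3 : (L.derivWeierstrassP ^ 2) =ᶠ[𝓝 w]
        fun w ↦ 4 * L.weierstrassP w ^ 3 - L.g₂ * L.weierstrassP w - L.g₃ := by
      filter_upwards [L.eventually_nhds_notMem_lattice hw] with v hv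
        using L.derivWeierstrassP_sq v hv
    have h4 := (h1.congr_of_eventuallyEq h3.symm).unique h2
    apply mul_left_cancel₀ (mul_ne_zero two_ne_zero hw0)
    norm_num at h4
    linear_combination h4
  have ha := L.analyticAt_derivWeierstrassP hz
  have h1 : Tendsto (deriv L.derivWeierstrassP) (𝓝[≠] z) (𝓝 (deriv L.derivWeierstrassP z)) :=
    ha.deriv.continuousAt.tendsto.mono_left nhdsWithin_le_nhds
  have h2 : Tendsto (fun w ↦ 6 * L.weierstrassP w ^ 2 - L.g₂ / 2) (𝓝[≠] z)
      (𝓝 (6 * L.weierstrassP z ^ 2 - L.g₂ / 2)) := by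
    refine Tendsto.mono_left ?_ nhdsWithin_le_nhds
    have := (L.analyticAt_weierstrassP hz).continuousAt
    exact ((continuousAt_const.mul (this.pow 2)).sub continuousAt_const).tendsto
  refine tendsto_nhds_unique_of_eventuallyEq h1 h2 ?_
  filter_upwards [mem_nhdsWithin_of_mem_nhds (L.eventually_nhds_notMem_lattice hz),
    eventually_codiscrete_iff_nhdsNE.1 (L.eventually_derivWeierstrassP_ne 0) z] with w h h'
    using key w h h'

lemma hasDerivAt_derivWeierstrassP {z : ℂ} (hz : z ∉ L.lattice) :
    HasDerivAt L.derivWeierstrassP (6 * L.weierstrassP z ^ 2 - L.g₂ / 2) z := by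
  rw [← L.deriv_derivWeierstrassP hz]
  exact (L.analyticAt_derivWeierstrassP hz).differentiableAt.hasDerivAt

/-- The periods of the Weierstrass function are the elements of the lattice. -/
lemma mem_lattice_of_weierstrassP_periodic {l : ℂ}
    (h : (fun z ↦ L.weierstrassP (z + l)) =ᶠ[codiscrete ℂ] L.weierstrassP) : l ∈ L.lattice := by
  rw [← L.order_weierstrassP_neg_iff, ← zero_add l, ← meromorphicOrderAt_comp_add_const,
    meromorphicOrderAt_congr_codiscrete h, L.order_weierstrassP_neg_iff]
  exact zero_mem _

/-- A point modulo the lattice is determined by the values of `℘` and `℘'`. -/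
lemma sub_mem_lattice_of_weierstrassP_eq {z u : ℂ} (hz : z ∉ L.lattice) (hu : u ∉ L.lattice)
    (h : L.weierstrassP z = L.weierstrassP u) (h' : L.derivWeierstrassP z = L.derivWeierstrassP u) :
    z - u ∈ L.lattice := by
  have hev : ∀ a ∉ L.lattice, ∀ᶠ s in 𝓝 (0 : ℂ), s + a ∉ L.lattice := fun a ha ↦
    ((continuous_add_const a).tendsto' 0 a (zero_add a)).eventually
      (L.eventually_nhds_notMem_lattice ha)
  have hz' := hev z hz
  have hu' := hev u hu
  have hc : ∀ a ∉ L.lattice, AnalyticAt ℂ (fun s ↦ L.weierstrassP (s + a)) 0 := fun a ha ↦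
    (L.analyticAt_weierstrassP (by simpa using ha)).fun_comp (f := fun s ↦ s + a) (by fun_prop)
  have hd : AnalyticAt ℂ (fun s ↦ L.weierstrassP (s + z) - L.weierstrassP (s + u)) 0 :=
    (hc z hz).sub (hc u hu)
  have hd1 : deriv (fun s ↦ L.weierstrassP (s + z) - L.weierstrassP (s + u)) =ᶠ[𝓝 0]
      fun s ↦ L.derivWeierstrassP (s + z) - L.derivWeierstrassP (s + u) := by
    filter_upwards [hz', hu'] with s h1 h2
    exact (((L.hasDerivAt_weierstrassP h1).comp_add_const s z).sub
      ((L.hasDerivAt_weierstrassP h2).comp_add_const s u)).deriv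
  -- The difference of the two translates of `℘` solves a linear equation, because `6 x² - 6 y² = 6
  -- (x + y)(x - y)`, and has zero initial data. So the translates coincide and `z - u` is a period.
  have hzero := eventually_eq_zero_of_deriv_deriv_eq_mul hd
    (g := fun s ↦ 6 * (L.weierstrassP (s + z) + L.weierstrassP (s + u)))
    (analyticAt_const.mul ((hc z hz).add (hc u hu))) (hd1.deriv.trans ?_) (by simp [h])
    (by rw [hd1.eq_of_nhds]; simp [h'])
  · have h1 := eventuallyEq_codiscrete_of_eventuallyEq_nhdsNE
      (L.isElliptic_weierstrassP.comp_add_const z).meromorphic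
      (L.isElliptic_weierstrassP.comp_add_const u).meromorphic (z := 0)
      ((hzero.mono fun s hs ↦ sub_eq_zero.1 hs).filter_mono nhdsWithin_le_nhds)
    apply L.mem_lattice_of_weierstrassP_periodic
    filter_upwards [(tendsto_sub_const_codiscrete u).eventually h1] with s hs
    convert hs using 2 <;> ring
  · filter_upwards [hz', hu'] with s h1 h2
    refine (((L.hasDerivAt_derivWeierstrassP h1).comp_add_const s z).sub
      ((L.hasDerivAt_derivWeierstrassP h2).comp_add_const s u)).deriv.trans ?_
    ring

lemma neg_mem_lattice_iff {z : ℂ} : -z ∈ L.lattice ↔ z ∈ L.lattice := neg_mem_iff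

/-- The points `u` and `-u` agree modulo the lattice, and `℘'` is odd. -/
lemma derivWeierstrassP_eq_zero_of_two_mul_mem {u : ℂ} (h : 2 * u ∈ L.lattice) :
    L.derivWeierstrassP u = 0 := by
  have h1 := L.derivWeierstrassP_add_coe (-u) ⟨_, h⟩
  have h2 : -u + 2 * u = u := by ring
  simp only [h2, L.derivWeierstrassP_neg] at h1
  exact self_eq_neg.1 h1

/-- The zeros of `℘'` are simple. If `℘''` vanished too, then `g₂ = 12 ℘(u)²` and `℘'' = 6 (℘ +
℘(u)) (℘ - ℘(u))`, so `℘ - ℘(u)` would solve a linear equation with zero initial data and `℘` would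
be constant. -/
lemma deriv_derivWeierstrassP_ne_zero {u : ℂ} (hu : u ∉ L.lattice)
    (h : L.derivWeierstrassP u = 0) : 6 * L.weierstrassP u ^ 2 - L.g₂ / 2 ≠ 0 := by
  intro h2
  have hd : AnalyticAt ℂ (fun s ↦ L.weierstrassP s - L.weierstrassP u) u :=
    (L.analyticAt_weierstrassP hu).sub analyticAt_const
  have hd1 : deriv (fun s ↦ L.weierstrassP s - L.weierstrassP u) =ᶠ[𝓝 u]
      L.derivWeierstrassP := by
    filter_upwards [L.eventually_nhds_notMem_lattice hu] with s h1
    exact ((L.hasDerivAt_weierstrassP h1).sub_const _).deriv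
  have hzero := eventually_eq_zero_of_deriv_deriv_eq_mul hd
    (g := fun s ↦ 6 * (L.weierstrassP s + L.weierstrassP u))
    (analyticAt_const.mul ((L.analyticAt_weierstrassP hu).add analyticAt_const))
    (hd1.deriv.trans ?_) (by simp) (by rw [hd1.eq_of_nhds, h])
  · obtain ⟨w, hw, hw'⟩ := ((hzero.filter_mono nhdsWithin_le_nhds).and
      (eventually_codiscrete_iff_nhdsNE.1 (L.eventually_weierstrassP_ne _) u)).exists
    exact hw' (sub_eq_zero.1 hw)
  · filter_upwards [L.eventually_nhds_notMem_lattice hu] with s h1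
    rw [L.deriv_derivWeierstrassP h1]
    linear_combination h2

lemma order_weierstrassP_sub_const (a : ℂ) {l : ℂ} (hl : l ∈ L.lattice) :
    meromorphicOrderAt (fun z ↦ L.weierstrassP z - a) l = -2 := by
  rw [meromorphicOrderAt_sub_const (L.order_weierstrassP_neg_iff.2 hl), L.order_weierstrassP l hl]

/-- The Weierstrass function takes every value. -/
lemma exists_weierstrassP_eq (a : ℂ) : ∃ u, u ∉ L.lattice ∧ L.weierstrassP u = a := by
  by_contra! hne
  -- If `a` were omitted, `1 / (℘ - a)` would have no poles and be constant, although it has a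
  -- double zero at each lattice point.
  have hinv : ∀ l ∈ L.lattice, meromorphicOrderAt (fun z ↦ (L.weierstrassP z - a)⁻¹) l = 2 :=
    fun l hl ↦ by
      refine (meromorphicOrderAt_inv (f := fun z ↦ L.weierstrassP z - a)).trans ?_
      rw [L.order_weierstrassP_sub_const a hl]; rfl
  have hel := (L.isElliptic_weierstrassP.sub (.const a)).inv
  obtain ⟨c, hc⟩ := hel.exists_const fun z ↦ by
    by_cases hz : z ∈ L.lattice
    · rw [hinv z hz]; decide
    · exact (((L.analyticAt_weierstrassP hz).sub analyticAt_const).inv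
        (sub_ne_zero.2 (hne z hz))).meromorphicOrderAt_nonneg
  have h1 := hinv 0 (zero_mem _)
  classical
  rw [meromorphicOrderAt_congr_codiscrete hc, meromorphicOrderAt_const] at h1
  split_ifs at h1
  · exact absurd h1 (by decide)
  · exact absurd h1 (by decide)

/-- The values of the Weierstrass function at the half periods are distinct roots of the
associated cubic. -/
lemma exists_distinct_roots : ∃ e₁ e₂ e₃ : ℂ, e₁ ≠ e₂ ∧ e₁ ≠ e₃ ∧ e₂ ≠ e₃ ∧
    ∀ e ∈ ({e₁, e₂, e₃} : Set ℂ), 4 * e ^ 3 - L.g₂ * e - L.g₃ = 0 := by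
  have hmem : ∀ a b : ℚ, a * L.ω₁ + b * L.ω₂ ∈ L.lattice → a.den = 1 ∧ b.den = 1 :=
    fun a b h ↦ L.mul_ω₁_add_mul_ω₂_mem_lattice.1 h
  have h1 : L.ω₁ / 2 ∉ L.lattice := L.ω₁_div_two_notMem_lattice
  have h2 : L.ω₂ / 2 ∉ L.lattice := L.ω₂_div_two_notMem_lattice
  have h3 : L.ω₁ / 2 + L.ω₂ / 2 ∉ L.lattice := fun h ↦ by
    have := (hmem (1 / 2) (1 / 2) (by convert h using 1; push_cast; ring)).1
    norm_num at this
  have d1 : L.derivWeierstrassP (L.ω₁ / 2) = 0 :=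
    L.derivWeierstrassP_eq_zero_of_two_mul_mem (by convert L.ω₁_mem_lattice using 1; ring)
  have d2 : L.derivWeierstrassP (L.ω₂ / 2) = 0 :=
    L.derivWeierstrassP_eq_zero_of_two_mul_mem (by convert L.ω₂_mem_lattice using 1; ring)
  have d3 : L.derivWeierstrassP (L.ω₁ / 2 + L.ω₂ / 2) = 0 :=
    L.derivWeierstrassP_eq_zero_of_two_mul_mem
      (by convert add_mem L.ω₁_mem_lattice L.ω₂_mem_lattice using 1; ring)
  -- Since `℘'` vanishes at all three half periods, equality of two values of `℘` would put a
  -- difference of half periods in the lattice.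
  refine ⟨L.weierstrassP (L.ω₁ / 2), L.weierstrassP (L.ω₂ / 2),
    L.weierstrassP (L.ω₁ / 2 + L.ω₂ / 2), fun h ↦ ?_, fun h ↦ ?_, fun h ↦ ?_, ?_⟩
  · have := L.sub_mem_lattice_of_weierstrassP_eq h1 h2 h (d1.trans d2.symm)
    have := (hmem (1 / 2) (-1 / 2) (by convert this using 1; push_cast; ring)).1
    norm_num at this
  · have := L.sub_mem_lattice_of_weierstrassP_eq h1 h3 h (d1.trans d3.symm)
    exact h2 (by convert neg_mem this using 1; ring)
  · have := L.sub_mem_lattice_of_weierstrassP_eq h2 h3 h (d2.trans d3.symm)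
    exact h1 (by convert neg_mem this using 1; ring)
  · rintro e (rfl | rfl | rfl)
    · rw [← L.derivWeierstrassP_sq _ h1, d1]; ring
    · rw [← L.derivWeierstrassP_sq _ h2, d2]; ring
    · rw [← L.derivWeierstrassP_sq _ h3, d3]; ring

end PeriodPair

lemma WithTop.coe_int_lt_iff_add_one_le {n : ℤ} {x : WithTop ℤ} :
    (n : WithTop ℤ) < x ↔ ((n + 1 : ℤ) : WithTop ℤ) ≤ x := by
  cases x with
  | top => simp
  | coe m => rw [WithTop.coe_lt_coe, WithTop.coe_le_coe, Int.add_one_le_iff]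

/-! ### Leading terms -/

/-- Subtracting a multiple of `g` cancels the leading term of `f`. -/
lemma exists_lt_meromorphicOrderAt_sub_mul {f g : ℂ → ℂ} {z : ℂ} (hf : MeromorphicAt f z)
    (hg : MeromorphicAt g z) (hg' : meromorphicOrderAt g z ≠ ⊤)
    (h : meromorphicOrderAt g z ≤ meromorphicOrderAt f z) :
    ∃ c, meromorphicOrderAt g z < meromorphicOrderAt (fun w ↦ f w - c * g w) z := by
  have hq : MeromorphicAt (fun w ↦ f w / g w) z := hf.fun_div hg
  have hqo : meromorphicOrderAt (fun w ↦ f w / g w) z + meromorphicOrderAt g z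
      = meromorphicOrderAt f z := by
    rw [← fun_meromorphicOrderAt_mul hq hg]
    apply meromorphicOrderAt_congr
    filter_upwards [(meromorphicOrderAt_ne_top_iff_eventually_ne_zero hg).1 hg'] with w hw
      using div_mul_cancel₀ _ hw
  have hq0 : 0 ≤ meromorphicOrderAt (fun w ↦ f w / g w) z := by
    rw [← hqo] at h
    lift meromorphicOrderAt g z to ℤ using hg' with n
    cases hc : meromorphicOrderAt (fun w ↦ f w / g w) z with
    | top => exact le_top
    | coe m => rw [hc] at h; norm_cast at h ⊢; linarith
  -- The required constant is the limit of `f / g`.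
  obtain ⟨c, hc⟩ := tendsto_nhds_of_meromorphicOrderAt_nonneg hq hq0
  have hp : 0 < meromorphicOrderAt (fun w ↦ f w / g w - c) z := by
    rw [← tendsto_zero_iff_meromorphicOrderAt_pos (by fun_prop)]
    simpa using hc.sub_const c
  refine ⟨c, ?_⟩
  have he : meromorphicOrderAt (fun w ↦ f w - c * g w) z
      = meromorphicOrderAt (fun w ↦ f w / g w - c) z + meromorphicOrderAt g z := by
    rw [← fun_meromorphicOrderAt_mul (by fun_prop) hg]
    apply meromorphicOrderAt_congr
    filter_upwards [(meromorphicOrderAt_ne_top_iff_eventually_ne_zero hg).1 hg'] with w hw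
    rw [sub_mul, div_mul_cancel₀ _ hw]
  rw [he]
  lift meromorphicOrderAt g z to ℤ using hg' with n
  cases hc : meromorphicOrderAt (fun w ↦ f w / g w - c) z with
  | top => exact WithTop.coe_lt_top n
  | coe m => rw [hc] at hp; norm_cast at hp ⊢; linarith

lemma meromorphicOrderAt_sub_nonneg {f g : ℂ → ℂ} {z : ℂ} (hf : MeromorphicAt f z)
    (hg : MeromorphicAt g z) (h : 0 ≤ meromorphicOrderAt f z) (h' : 0 ≤ meromorphicOrderAt g z) :
    0 ≤ meromorphicOrderAt (fun w ↦ f w - g w) z := by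
  simp only [sub_eq_add_neg]
  refine le_trans (le_min h ?_) (meromorphicOrderAt_add hf hg.neg)
  rwa [← meromorphicOrderAt_fun_neg]

lemma meromorphicOrderAt_const_mul_nonneg {f : ℂ → ℂ} {z : ℂ} (hf : MeromorphicAt f z)
    (h : 0 ≤ meromorphicOrderAt f z) (c : ℂ) : 0 ≤ meromorphicOrderAt (fun w ↦ c * f w) z := by
  rw [fun_meromorphicOrderAt_mul (.const _ _) hf]
  exact add_nonneg (AnalyticAt.meromorphicOrderAt_nonneg analyticAt_const) h

lemma meromorphicOrderAt_const_mul {f : ℂ → ℂ} {z : ℂ} {c : ℂ} (hc : c ≠ 0) :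
    meromorphicOrderAt (fun w ↦ c * f w) z = meromorphicOrderAt f z :=
  meromorphicOrderAt_mul_of_ne_zero (g := fun _ ↦ c) analyticAt_const hc

lemma meromorphicOrderAt_deriv_nonneg {f : ℂ → ℂ} {z : ℂ} (hf : MeromorphicAt f z)
    (h : 0 ≤ meromorphicOrderAt f z) : 0 ≤ meromorphicOrderAt (deriv f) z := by
  obtain ⟨g, hg, hfg⟩ := hf.meromorphicOrderAt_nonneg_iff.1 h
  rw [meromorphicOrderAt_congr hfg.nhdsNE_deriv]
  exact hg.deriv.meromorphicOrderAt_nonneg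

/-- An even function has no simple pole at the origin. -/
lemma meromorphicOrderAt_zero_nonneg_of_even {f : ℂ → ℂ} (hf : MeromorphicAt f 0)
    (h : -1 ≤ meromorphicOrderAt f 0) (he : ∀ᶠ z in 𝓝[≠] 0, f (-z) = f z) :
    0 ≤ meromorphicOrderAt f 0 := by
  have hne : meromorphicOrderAt f 0 ≠ -1 := fun h1 ↦ by
    obtain ⟨g, hg, hg0, hfg⟩ := (meromorphicOrderAt_eq_int_iff (n := -1) hf).1 h1
    have hn : Tendsto (fun z : ℂ ↦ -z) (𝓝[≠] 0) (𝓝[≠] 0) := by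
      simpa using tendsto_nhdsNE_of_injective (continuous_neg (G := ℂ)) neg_injective 0
    -- With `f = g / z`, evenness of `f` makes `g` odd, so `2 g(0) = 0` in the limit, against the
    -- choice of `g`.
    have h2 : ∀ᶠ z in 𝓝[≠] (0 : ℂ), g z + g (-z) = 0 := by
      filter_upwards [hfg, hn.eventually hfg, he, self_mem_nhdsWithin] with z h3 h4 h5 h6
      have h6' : z ≠ 0 := h6
      simp only [sub_zero, zpow_neg_one, smul_eq_mul] at h3 h4
      rw [h3, h4, inv_neg] at h5
      have : z⁻¹ * (g z + g (-z)) = 0 := by linear_combination -h5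
      simpa [h6'] using this
    have h3 : Tendsto (fun z ↦ g z + g (-z)) (𝓝[≠] 0) (𝓝 (g 0 + g 0)) := by
      refine Tendsto.add (hg.continuousAt.tendsto.mono_left nhdsWithin_le_nhds) ?_
      exact (hg.continuousAt.tendsto.mono_left nhdsWithin_le_nhds).comp hn
    have h4 := tendsto_nhds_unique (h3.congr' h2) tendsto_const_nhds
    exact hg0 (add_self_eq_zero.1 h4)
  exact WithTop.coe_int_lt_iff_add_one_le (n := -1).1 (lt_of_le_of_ne h hne.symm)

/-- A meromorphic function with a pole satisfies no algebraic equation. -/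
lemma Polynomial.eq_zero_of_eventually_eval_eq_zero {f : ℂ → ℂ} (hf : Meromorphic f) {z : ℂ}
    (h : meromorphicOrderAt f z < 0) {p : Polynomial ℂ}
    (hp : ∀ᶠ w in codiscrete ℂ, p.eval (f w) = 0) : p = 0 := by
  by_contra hne
  have h1 : ∀ᶠ w in codiscrete ℂ, ∀ a ∈ p.roots.toFinset, f w ≠ a :=
    (Finset.eventually_all _).2 fun a _ ↦ eventually_codiscrete_sub_const_ne_zero hf h a
  have := codiscrete_neBot
  obtain ⟨w, hw, hw'⟩ := (h1.and hp).exists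
  exact hw _ (by simpa [hne] using hw') rfl

/-! ### The case of one simple pole, without residues -/

namespace PeriodPair

variable {L : PeriodPair}

lemma IsElliptic.order_eq_of_sub_mem {f : ℂ → ℂ} (hf : L.IsElliptic f) {a z : ℂ}
    (h : z - a ∈ L.lattice) : meromorphicOrderAt f z = meromorphicOrderAt f a := by
  rw [← hf.order_add_of_mem h a, add_sub_cancel]

/-- No elliptic function has a single simple pole modulo its period lattice. -/
theorem IsElliptic.exists_const_of_simple_pole {f : ℂ → ℂ} (hf : L.IsElliptic f)
    (h : ∀ z ∉ L.lattice, 0 ≤ meromorphicOrderAt f z) (h0 : -1 ≤ meromorphicOrderAt f 0) :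
    ∃ c, f =ᶠ[codiscrete ℂ] fun _ ↦ c := by
  have hreg : ∀ g, L.IsElliptic g → (∀ z ∉ L.lattice, 0 ≤ meromorphicOrderAt g z) →
      0 ≤ meromorphicOrderAt g 0 → ∃ c, g =ᶠ[codiscrete ℂ] fun _ ↦ c := fun g hg h1 h2 ↦
    hg.exists_const fun z ↦ by
      by_cases hz : z ∈ L.lattice
      · rwa [hg.order_eq_of_sub_mem (a := 0) (by simpa using hz)]
      · exact h1 z hz
  by_cases hpos : 0 ≤ meromorphicOrderAt f 0
  · exact hreg f hf h hpos
  have hneg : meromorphicOrderAt f 0 = -1 := (h0.eq_or_lt.resolve_right fun h1 ↦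
    hpos (WithTop.coe_int_lt_iff_add_one_le (n := -1).1 h1)).symm
  exfalso
  -- Antisymmetrising doubles the residue, so the simple pole survives, while `F²` and `F'` are even
  -- with a double pole.
  set F : ℂ → ℂ := fun z ↦ f z - f (-z) with hF
  have hFe : L.IsElliptic F := hf.sub hf.comp_neg
  have hFm := hFe.meromorphic
  have hodd : ∀ z, F (-z) = -F z := fun z ↦ by simp [hF]
  have hFreg : ∀ z ∉ L.lattice, 0 ≤ meromorphicOrderAt F z := fun z hz ↦
    meromorphicOrderAt_sub_nonneg (hf.meromorphic z) (hf.comp_neg.meromorphic z) (h z hz) (by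
      rw [meromorphicOrderAt_comp_neg]; exact h _ (by rwa [L.neg_mem_lattice_iff]))
  have hF0 : meromorphicOrderAt F 0 = -1 := by
    obtain ⟨g, hg, hg0, hfg⟩ := (meromorphicOrderAt_eq_int_iff (n := -1) (hf.meromorphic 0)).1 hneg
    refine (meromorphicOrderAt_eq_int_iff (n := -1) (hFm 0)).2 ⟨fun z ↦ g z + g (-z), ?_, ?_, ?_⟩
    · exact hg.add ((hg.congr (by simp) : AnalyticAt ℂ g 0).comp_of_eq (by fun_prop) (by simp))
    · simpa using hg0
    · have hn : Tendsto (fun z : ℂ ↦ -z) (𝓝[≠] 0) (𝓝[≠] 0) := by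
        simpa using tendsto_nhdsNE_of_injective (continuous_neg (G := ℂ)) neg_injective 0
      filter_upwards [hfg, hn.eventually hfg] with z h1 h2
      simp only [hF, h1, h2, sub_zero, zpow_neg_one, smul_eq_mul, inv_neg]
      ring
  have heven : ∀ z, _root_.deriv F (-z) = _root_.deriv F z := fun z ↦ by
    have h1 : _root_.deriv (fun w ↦ F (-w)) z = -_root_.deriv F (-z) := deriv_comp_neg F z
    have h2 : (fun w ↦ F (-w)) = fun w ↦ -F w := funext hodd
    rw [h2, deriv.fun_neg] at h1
    exact (neg_inj.1 h1).symm
  have hP0 := L.order_weierstrassP 0 (zero_mem _)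
  have hPm := L.meromorphic_weierstrassP
  -- After the leading multiple of `℘` is subtracted, the pole is at most simple, and evenness rules
  -- that out. Liouville's theorem makes the remainder constant.
  have htwo : ∀ g : ℂ → ℂ, L.IsElliptic g → (∀ z ∉ L.lattice, 0 ≤ meromorphicOrderAt g z) →
      meromorphicOrderAt g 0 = -2 → (∀ z, g (-z) = g z) →
      ∃ a b, a ≠ 0 ∧ g =ᶠ[codiscrete ℂ] fun z ↦ a * L.weierstrassP z + b := by
    intro g hg h1 h2 h3
    obtain ⟨a, ha⟩ := exists_lt_meromorphicOrderAt_sub_mul (hg.meromorphic 0) (hPm 0)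
      (L.order_weierstrassP_ne_top 0) (by rw [h2, hP0])
    have hge := hg.sub (L.isElliptic_weierstrassP.const_mul a)
    rw [hP0] at ha
    have ha' := WithTop.coe_int_lt_iff_add_one_le (n := -2).1 ha
    obtain ⟨b, hb⟩ := hreg _ hge (fun z hz ↦ meromorphicOrderAt_sub_nonneg (hg.meromorphic z)
        (by fun_prop) (h1 z hz) (meromorphicOrderAt_const_mul_nonneg (hPm z)
          (L.analyticAt_weierstrassP hz).meromorphicOrderAt_nonneg a))
      (meromorphicOrderAt_zero_nonneg_of_even (hge.meromorphic 0) ha' (.of_forall fun z ↦ by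
        simp [h3]))
    have hgab : g =ᶠ[codiscrete ℂ] fun z ↦ a * L.weierstrassP z + b := by
      filter_upwards [hb] with z hz
      linear_combination hz
    refine ⟨a, b, ?_, hgab⟩
    rintro rfl
    have h4 : (0 : WithTop ℤ) ≤ meromorphicOrderAt (fun _ : ℂ ↦ b) 0 :=
      AnalyticAt.meromorphicOrderAt_nonneg analyticAt_const
    have h5 : g =ᶠ[codiscrete ℂ] fun _ ↦ b := by simpa using hgab
    rw [← meromorphicOrderAt_congr_codiscrete h5, h2] at h4
    exact absurd h4 (by decide)
  obtain ⟨ρ, D, hρ, h1⟩ := htwo (fun z ↦ F z ^ 2) (hFe.pow 2) (fun z hz ↦ by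
      simp only [sq]
      rw [fun_meromorphicOrderAt_mul (hFm z) (hFm z)]
      exact add_nonneg (hFreg z hz) (hFreg z hz))
    (by rw [fun_meromorphicOrderAt_pow (hFm 0), hF0]; rfl) (fun z ↦ by simp [hodd])
  obtain ⟨σ, C, hσ, h2⟩ := htwo (_root_.deriv F) hFe.deriv
    (fun z hz ↦ meromorphicOrderAt_deriv_nonneg (hFm z) (hFreg z hz))
    (meromorphicOrderAt_deriv_eq_sub_one (n := -1) (by norm_num) hF0) heven
  -- Differentiating `F² = ρ ℘ + D` gives `2 F F' = ρ ℘'`; this is squared, and `F' = σ ℘ + C` and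
  -- the cubic relation are inserted.
  have h3 : ∀ᶠ z in codiscrete ℂ, 4 * (ρ * L.weierstrassP z + D) * (σ * L.weierstrassP z + C) ^ 2
      = ρ ^ 2 * (4 * L.weierstrassP z ^ 3 - L.g₂ * L.weierstrassP z - L.g₃) := by
    filter_upwards [h1, h2, deriv_eventuallyEq_codiscrete h1, eventually_codiscrete_analyticAt hFm,
      L.eventually_notMem_lattice] with z e1 e2 e3 e4 e5
    rw [← e1, ← e2, ← L.derivWeierstrassP_sq z e5]
    have e6 := (((L.hasDerivAt_weierstrassP e5).const_mul ρ).add_const D).deriv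
    have e7 := (e4.differentiableAt.hasDerivAt.fun_pow 2).deriv
    rw [e3, e6] at e7
    norm_num at e7
    linear_combination (-ρ * L.derivWeierstrassP z - 2 * F z * _root_.deriv F z) * e7
  set p : Polynomial ℂ := 4 * (.C ρ * .X + .C D) * (.C σ * .X + .C C) ^ 2 -
    .C (ρ ^ 2) * (4 * .X ^ 3 - .C L.g₂ * .X - .C L.g₃) with hp
  have hp0 : p = 0 := Polynomial.eq_zero_of_eventually_eval_eq_zero hPm
    (L.order_weierstrassP_neg_iff.2 (zero_mem _)) (h3.mono fun z hz ↦ by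
      simp [hp, hz])
  -- The relation is a polynomial identity, so the cubic has at most two different roots, which
  -- contradicts the three half-period values.
  have h4 : ∀ x, 4 * x ^ 3 - L.g₂ * x - L.g₃ = 0 → x = -D / ρ ∨ x = -C / σ := fun x hx ↦ by
    have h5 : p.eval x = 0 := by simp [hp0]
    have h6 : (ρ * x + D) * (σ * x + C) ^ 2 = 0 := by
      simp only [hp, Polynomial.eval_sub, Polynomial.eval_mul, Polynomial.eval_add,
        Polynomial.eval_pow, Polynomial.eval_C, Polynomial.eval_X, Polynomial.eval_ofNat] at h5
      linear_combination h5 / 4 + ρ ^ 2 * hx / 4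
    rcases mul_eq_zero.1 h6 with h7 | h7
    · left; rw [eq_div_iff hρ]; linear_combination h7
    · right; rw [eq_div_iff hσ]; linear_combination pow_eq_zero_iff two_ne_zero |>.1 h7
  obtain ⟨e₁, e₂, e₃, h12, h13, h23, he⟩ := L.exists_distinct_roots
  have r1 := h4 e₁ (he _ (by simp))
  have r2 := h4 e₂ (he _ (by simp))
  have r3 := h4 e₃ (he _ (by simp))
  rcases r1 with r1 | r1 <;> rcases r2 with r2 | r2 <;> rcases r3 with r3 | r3 <;>
    simp_all

end PeriodPair

/-! ### The normal forms: the quotient with two simple poles, and `℘` itself -/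

namespace PeriodPair

variable (L : PeriodPair)

/-- The function `(℘' + B) / (2 (℘ - A))`. For `B² = 4A³ - g₂ A - g₃` it has two simple poles. -/
def addQuotient (A B z : ℂ) : ℂ :=
  (L.derivWeierstrassP z + B) / (2 * (L.weierstrassP z - A))

lemma isElliptic_addQuotient (A B : ℂ) : L.IsElliptic (L.addQuotient A B) :=
  (L.isElliptic_derivWeierstrassP.add (.const B)).div
    ((IsElliptic.const 2).mul (L.isElliptic_weierstrassP.sub (.const A)))

lemma order_addQuotient (A B z : ℂ) : meromorphicOrderAt (L.addQuotient A B) z =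
    meromorphicOrderAt (fun w ↦ L.derivWeierstrassP w + B) z -
      meromorphicOrderAt (fun w ↦ L.weierstrassP w - A) z := by
  rw [← meromorphicOrderAt_const_mul (f := fun w ↦ L.weierstrassP w - A) (two_ne_zero (α := ℂ))]
  exact fun_meromorphicOrderAt_div
    ((L.isElliptic_derivWeierstrassP.add (.const B)).meromorphic z)
    (((IsElliptic.const 2).mul (L.isElliptic_weierstrassP.sub (.const A))).meromorphic z)

lemma order_addQuotient_of_mem (A B : ℂ) {l : ℂ} (hl : l ∈ L.lattice) :
    meromorphicOrderAt (L.addQuotient A B) l = -1 := by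
  have h : meromorphicOrderAt (fun w ↦ L.derivWeierstrassP w + B) l = -3 := by
    rw [← L.order_derivWeierstrassP l hl]
    exact meromorphicOrderAt_add_of_nonneg (.const _ _)
      (by rw [L.order_derivWeierstrassP l hl]; decide)
      (AnalyticAt.meromorphicOrderAt_nonneg analyticAt_const)
  rw [order_addQuotient, h, L.order_weierstrassP_sub_const A hl]
  rfl

lemma order_eq_one_of_deriv_ne_zero {f : ℂ → ℂ} {z : ℂ} (hf : AnalyticAt ℂ f z) (h0 : f z = 0)
    (h1 : deriv f z ≠ 0) : meromorphicOrderAt f z = 1 := by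
  have h2 : analyticOrderAt f z = 1 := by
    simpa [h0] using hf.analyticOrderAt_sub_eq_one_of_deriv_ne_zero h1
  rw [hf.meromorphicOrderAt_eq, h2]
  rfl

lemma order_eq_zero_of_ne_zero {f : ℂ → ℂ} {z : ℂ} (hf : AnalyticAt ℂ f z) (h0 : f z ≠ 0) :
    meromorphicOrderAt f z = 0 := by
  rw [hf.meromorphicOrderAt_eq, hf.analyticOrderAt_eq_zero.2 h0]
  rfl

/-- The order of `(℘' + B) / (2 (℘ - A))` off the lattice. -/
lemma order_addQuotient_of_notMem {u : ℂ} (hu : u ∉ L.lattice) {z : ℂ} (hz : z ∉ L.lattice) :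
    (z - u ∈ L.lattice → meromorphicOrderAt
      (L.addQuotient (L.weierstrassP u) (L.derivWeierstrassP u)) z = -1) ∧
    (z - u ∉ L.lattice → 0 ≤ meromorphicOrderAt
      (L.addQuotient (L.weierstrassP u) (L.derivWeierstrassP u)) z) := by
  have hPa := L.analyticAt_weierstrassP hz
  have hDa := L.analyticAt_derivWeierstrassP hz
  have hN : AnalyticAt ℂ (fun w ↦ L.derivWeierstrassP w + L.derivWeierstrassP u) z :=
    hDa.add analyticAt_const
  have hQ : AnalyticAt ℂ (fun w ↦ L.weierstrassP w - L.weierstrassP u) z :=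
    hPa.sub analyticAt_const
  have hQd : deriv (fun w ↦ L.weierstrassP w - L.weierstrassP u) z = L.derivWeierstrassP z :=
    ((L.hasDerivAt_weierstrassP hz).sub_const _).deriv
  have hmem : z - u ∈ L.lattice ↔ L.weierstrassP z = L.weierstrassP u ∧
      L.derivWeierstrassP z = L.derivWeierstrassP u := by
    refine ⟨fun h ↦ ?_, fun h ↦ L.sub_mem_lattice_of_weierstrassP_eq hz hu h.1 h.2⟩
    have h1 := L.weierstrassP_add_coe u ⟨_, h⟩
    have h2 := L.derivWeierstrassP_add_coe u ⟨_, h⟩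
    simp only [add_sub_cancel] at h1 h2
    exact ⟨h1, h2⟩
  rw [hmem, order_addQuotient]
  by_cases hP : L.weierstrassP z = L.weierstrassP u
  swap
  · refine ⟨fun h ↦ absurd h.1 hP, fun _ ↦ ?_⟩
    rw [order_eq_zero_of_ne_zero hQ (by simpa [sub_eq_zero] using hP)]
    exact hN.meromorphicOrderAt_nonneg.trans_eq (sub_zero _).symm
  have hsq : L.derivWeierstrassP z ^ 2 = L.derivWeierstrassP u ^ 2 := by
    rw [L.derivWeierstrassP_sq z hz, L.derivWeierstrassP_sq u hu, hP]
  -- Here `℘(z) = ℘(u)`. If `℘'(z) = 0`, the denominator has a double zero and the numerator a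
  -- simple one, so the pole is still simple.
  by_cases hD : L.derivWeierstrassP z = 0
  · have hDu : L.derivWeierstrassP u = 0 := by simpa [hD] using hsq.symm
    refine ⟨fun _ ↦ ?_, fun h ↦ absurd ⟨hP, hD.trans hDu.symm⟩ h⟩
    have h1 : meromorphicOrderAt (fun w ↦ L.derivWeierstrassP w + L.derivWeierstrassP u) z = 1 := by
      simp only [hDu, add_zero]
      exact order_eq_one_of_deriv_ne_zero hDa hD
        (by rw [L.deriv_derivWeierstrassP hz]; exact L.deriv_derivWeierstrassP_ne_zero hz hD)
    have h2 : meromorphicOrderAt (fun w ↦ L.weierstrassP w - L.weierstrassP u) z = 2 := by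
      have hd : deriv (fun w ↦ L.weierstrassP w - L.weierstrassP u) = L.derivWeierstrassP := by
        rw [← L.deriv_weierstrassP]; ext w; simp
      have h3 : analyticOrderAt L.derivWeierstrassP z = 1 := by
        have := hDa.analyticOrderAt_sub_eq_one_of_deriv_ne_zero
          (by rw [L.deriv_derivWeierstrassP hz]; exact L.deriv_derivWeierstrassP_ne_zero hz hD)
        simpa [hD] using this
      have h4 : analyticOrderAt (fun w ↦ L.weierstrassP w - L.weierstrassP u) z = 2 := by
        have h5 := AnalyticAt.analyticOrderAt_deriv_add_one hQ
        rw [hd, h3] at h5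
        simp only [hP, sub_self, sub_zero] at h5
        rw [← h5]; norm_num
      rw [hQ.meromorphicOrderAt_eq, h4]; rfl
    rw [h1, h2]; rfl
  -- Now the denominator has a simple zero. The numerator is nonzero when `℘'(z) = ℘'(u)`; in the
  -- other case, `℘'(z) = -℘'(u)`, it vanishes and cancels the pole.
  · have h2 : meromorphicOrderAt (fun w ↦ L.weierstrassP w - L.weierstrassP u) z = 1 :=
      order_eq_one_of_deriv_ne_zero hQ (by simp [hP]) (by rwa [← hQd] at hD)
    rw [h2]
    refine ⟨fun h ↦ ?_, fun h ↦ ?_⟩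
    · rw [order_eq_zero_of_ne_zero hN (by simpa [← h.2] using hD)]; rfl
    · have h3 : L.derivWeierstrassP z = -L.derivWeierstrassP u :=
        (sq_eq_sq_iff_eq_or_eq_neg.1 hsq).resolve_left fun h' ↦ h ⟨hP, h'⟩
      have h4 : 0 < meromorphicOrderAt
          (fun w ↦ L.derivWeierstrassP w + L.derivWeierstrassP u) z := by
        rw [← tendsto_zero_iff_meromorphicOrderAt_pos hN.meromorphicAt]
        have := hN.continuousAt.tendsto.mono_left (nhdsWithin_le_nhds (s := {z}ᶜ))
        simpa [h3] using this
      have h5 := WithTop.coe_int_lt_iff_add_one_le (n := 0).1 h4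
      cases hc : meromorphicOrderAt (fun w ↦ L.derivWeierstrassP w + L.derivWeierstrassP u) z with
      | top => exact le_top
      | coe m =>
        rw [hc] at h5
        have h6 : (0 + 1 : ℤ) ≤ m := WithTop.coe_le_coe.1 h5
        have h7 : (0 : ℤ) ≤ m - 1 := by omega
        exact WithTop.coe_le_coe.2 h7

variable {L} {A B : ℂ}

/-- A Riccati equation `φ' + φ² = 2℘ + A`. In the sum the terms linear in `℘'` cancel, leaving `B² -
℘'²`, which is divisible by `℘ - A` because `(A, B)` lies on the cubic. -/
lemma hasDerivAt_addQuotient (hB : B ^ 2 = 4 * A ^ 3 - L.g₂ * A - L.g₃) {z : ℂ}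
    (hz : z ∉ L.lattice) (hA : L.weierstrassP z ≠ A) :
    HasDerivAt (L.addQuotient A B)
      (2 * L.weierstrassP z + A - L.addQuotient A B z ^ 2) z := by
  have hA' : L.weierstrassP z - A ≠ 0 := sub_ne_zero.2 hA
  have h := ((L.hasDerivAt_derivWeierstrassP hz).add_const B).div
    (((L.hasDerivAt_weierstrassP hz).sub_const A).const_mul 2) (mul_ne_zero two_ne_zero hA')
  refine h.congr_deriv ?_
  have h3 := L.derivWeierstrassP_sq z hz
  rw [addQuotient]
  field_simp
  linear_combination -h3 + hB

/-- The square of the derivative of `(℘' + B) / (2 (℘ - A))`. -/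
lemma addQuotient_deriv_sq (hB : B ^ 2 = 4 * A ^ 3 - L.g₂ * A - L.g₃) {z : ℂ}
    (hz : z ∉ L.lattice) (hA : L.weierstrassP z ≠ A) :
    (2 * L.weierstrassP z + A - L.addQuotient A B z ^ 2) ^ 2 = L.addQuotient A B z ^ 4
      - 6 * A * L.addQuotient A B z ^ 2 - 4 * B * L.addQuotient A B z + L.g₂ - 3 * A ^ 2 := by
  have hA' : L.weierstrassP z - A ≠ 0 := sub_ne_zero.2 hA
  have h3 := L.derivWeierstrassP_sq z hz
  -- Insert `℘' = 2 φ (℘ - A) - B` into the cubic relation, subtract the relation for `(A, B)`, and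
  -- divide by `℘ - A`.
  have h4 : 4 * L.addQuotient A B z ^ 2 * (L.weierstrassP z - A) - 4 * B * L.addQuotient A B z
      - 4 * (L.weierstrassP z ^ 2 + A * L.weierstrassP z + A ^ 2) + L.g₂ = 0 := by
    rw [addQuotient]
    field_simp
    linear_combination 4 * h3 - 4 * hB
  linear_combination -h4

/-- The second derivative is `2℘' - 2φφ'`. After the substitution `℘' = 2φ(℘ - A) - B` all terms in
`℘` cancel, so `φ''` is a polynomial in `φ` alone. -/
lemma hasDerivAt_deriv_addQuotient (hB : B ^ 2 = 4 * A ^ 3 - L.g₂ * A - L.g₃) {z : ℂ}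
    (hz : z ∉ L.lattice) (hA : L.weierstrassP z ≠ A) :
    HasDerivAt (fun z ↦ 2 * L.weierstrassP z + A - L.addQuotient A B z ^ 2)
      (2 * L.addQuotient A B z ^ 3 - 6 * A * L.addQuotient A B z - 2 * B) z := by
  have h := (((L.hasDerivAt_weierstrassP hz).const_mul 2).add_const A).sub
    ((hasDerivAt_addQuotient hB hz hA).pow 2)
  refine h.congr_deriv ?_
  have hA' : L.weierstrassP z - A ≠ 0 := sub_ne_zero.2 hA
  have h1 : L.derivWeierstrassP z = 2 * L.addQuotient A B z * (L.weierstrassP z - A) - B := by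
    rw [addQuotient]; field_simp; ring
  rw [h1]
  norm_num
  ring

lemma eventually_regular (a : ℂ) :
    ∀ᶠ z in codiscrete ℂ, z ∉ L.lattice ∧ L.weierstrassP z ≠ a :=
  L.eventually_notMem_lattice.and (L.eventually_weierstrassP_ne a)

/-- Elliptic functions with two simple poles modulo the lattice. -/
theorem IsElliptic.eq_addQuotient {w : ℂ → ℂ} (hw : L.IsElliptic w) {a b : ℂ}
    (hab : b - a ∉ L.lattice) (ha : -1 ≤ meromorphicOrderAt w a)
    (hb : -1 ≤ meromorphicOrderAt w b)
    (hreg : ∀ z, z - a ∉ L.lattice → z - b ∉ L.lattice → 0 ≤ meromorphicOrderAt w z) :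
    ∃ k h₀, w =ᶠ[codiscrete ℂ] fun z ↦ k * L.addQuotient (L.weierstrassP (b - a))
      (L.derivWeierstrassP (b - a)) (z - a) + h₀ := by
  set u := b - a with hu
  set φ := L.addQuotient (L.weierstrassP u) (L.derivWeierstrassP u)
  have hφ : L.IsElliptic φ := L.isElliptic_addQuotient _ _
  have hφu : meromorphicOrderAt φ u = -1 :=
    (L.order_addQuotient_of_notMem hab hab).1 (by simp)
  have hv := hw.comp_add_const a
  have hvo : ∀ z, meromorphicOrderAt (fun z ↦ w (z + a)) z = meromorphicOrderAt w (z + a) :=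
    meromorphicOrderAt_comp_add_const w a
  -- With `a` moved to `0`, the multiple `k φ` is chosen to remove the pole at `u`. What remains has
  -- at most a simple pole at `0` and is therefore constant.
  obtain ⟨k, hk⟩ := exists_lt_meromorphicOrderAt_sub_mul (hv.meromorphic u) (hφ.meromorphic u)
    (by rw [hφu]; decide) (by rw [hφu, hvo]; simpa [hu] using hb)
  rw [hφu] at hk
  have hel := hv.sub (hφ.const_mul k)
  have hc := hel.exists_const_of_simple_pole (fun z hz ↦ ?_) ?_
  · obtain ⟨h₀, hh⟩ := hc
    refine ⟨k, h₀, ?_⟩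
    filter_upwards [(tendsto_sub_const_codiscrete a).eventually hh] with z hz
    simp only [sub_add_cancel] at hz
    linear_combination hz
  · by_cases hzu : z - u ∈ L.lattice
    · rw [hel.order_eq_of_sub_mem hzu]
      exact WithTop.coe_int_lt_iff_add_one_le (n := -1).1 hk
    · refine meromorphicOrderAt_sub_nonneg (hv.meromorphic z) ((hφ.const_mul k).meromorphic z) ?_
        (meromorphicOrderAt_const_mul_nonneg (hφ.meromorphic z)
          ((L.order_addQuotient_of_notMem hab hz).2 hzu) k)
      rw [hvo]
      exact hreg _ (by simpa using hz) (by convert hzu using 2; rw [hu]; ring)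
  · simp only [sub_eq_add_neg, ← neg_mul]
    refine le_trans (le_min ?_ ?_) (meromorphicOrderAt_add (hv.meromorphic 0)
      ((hφ.const_mul (-k)).meromorphic 0))
    · rw [hvo]; simpa using ha
    · rw [fun_meromorphicOrderAt_mul (.const _ _) (hφ.meromorphic 0),
        L.order_addQuotient_of_mem _ _ (zero_mem _)]
      exact le_add_of_nonneg_left (AnalyticAt.meromorphicOrderAt_nonneg analyticAt_const)

/-- Elliptic functions with one double pole modulo the lattice. -/
theorem IsElliptic.eq_weierstrassP {w : ℂ → ℂ} (hw : L.IsElliptic w) {a : ℂ}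
    (ha : -2 ≤ meromorphicOrderAt w a)
    (hreg : ∀ z, z - a ∉ L.lattice → 0 ≤ meromorphicOrderAt w z) :
    ∃ c h₀, w =ᶠ[codiscrete ℂ] fun z ↦ c * L.weierstrassP (z - a) + h₀ := by
  have hP := L.isElliptic_weierstrassP
  have hP0 := L.order_weierstrassP 0 (zero_mem _)
  have hv := hw.comp_add_const a
  have hvo : ∀ z, meromorphicOrderAt (fun z ↦ w (z + a)) z = meromorphicOrderAt w (z + a) :=
    meromorphicOrderAt_comp_add_const w a
  obtain ⟨k, hk⟩ := exists_lt_meromorphicOrderAt_sub_mul (hv.meromorphic 0) (hP.meromorphic 0)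
    (L.order_weierstrassP_ne_top 0) (by rw [hP0, hvo]; simpa using ha)
  rw [hP0] at hk
  have hel := hv.sub (hP.const_mul k)
  have hc := hel.exists_const_of_simple_pole (fun z hz ↦ ?_)
    (WithTop.coe_int_lt_iff_add_one_le (n := -2).1 hk)
  · obtain ⟨h₀, hh⟩ := hc
    refine ⟨k, h₀, ?_⟩
    filter_upwards [(tendsto_sub_const_codiscrete a).eventually hh] with z hz
    simp only [sub_add_cancel] at hz
    linear_combination hz
  · refine meromorphicOrderAt_sub_nonneg (hv.meromorphic z) ((hP.const_mul k).meromorphic z) ?_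
      (meromorphicOrderAt_const_mul_nonneg (hP.meromorphic z)
        (L.analyticAt_weierstrassP hz).meromorphicOrderAt_nonneg k)
    rw [hvo]
    exact hreg _ (by simpa using hz)

end PeriodPair

/-! ### Counting poles in the fundamental parallelogram -/

lemma poleMultiplicity_eq_zero {w : ℂ → ℂ} {z : ℂ} (h : 0 ≤ meromorphicOrderAt w z) :
    poleMultiplicity w z = 0 := by
  rw [poleMultiplicity, Int.toNat_eq_zero, neg_nonpos]
  cases hc : meromorphicOrderAt w z with
  | top => simp
  | coe m => rw [hc] at h; simpa using h

lemma poleMultiplicity_of_order_eq {w : ℂ → ℂ} {z : ℂ} {n : ℕ}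
    (h : meromorphicOrderAt w z = ((-n : ℤ) : WithTop ℤ)) : poleMultiplicity w z = n := by
  rw [poleMultiplicity, h]; simp

lemma neg_le_order_of_poleMultiplicity_le {w : ℂ → ℂ} {z : ℂ} {n : ℕ}
    (h : poleMultiplicity w z ≤ n) : ((-n : ℤ) : WithTop ℤ) ≤ meromorphicOrderAt w z := by
  rw [poleMultiplicity] at h
  cases hc : meromorphicOrderAt w z with
  | top => exact le_top
  | coe m =>
    rw [hc] at h
    simp only [WithTop.untop₀_coe] at h
    exact WithTop.coe_le_coe.2 (by omega)

lemma order_nonneg_of_poleMultiplicity_eq_zero {w : ℂ → ℂ} {z : ℂ}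
    (h : poleMultiplicity w z = 0) : 0 ≤ meromorphicOrderAt w z := by
  simpa using neg_le_order_of_poleMultiplicity_le h.le

lemma order_const_mul_add_of_neg {f : ℂ → ℂ} {z k : ℂ} (hk : k ≠ 0) (h₀ : ℂ)
    (h : meromorphicOrderAt f z < 0) :
    meromorphicOrderAt (fun w ↦ k * f w + h₀) z = meromorphicOrderAt f z := by
  rw [meromorphicOrderAt_add_of_nonneg (.const _ _) (by rwa [meromorphicOrderAt_const_mul hk])
    (AnalyticAt.meromorphicOrderAt_nonneg analyticAt_const), meromorphicOrderAt_const_mul hk]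

lemma order_const_mul_add_nonneg {f : ℂ → ℂ} {z : ℂ} (hf : MeromorphicAt f z) (k h₀ : ℂ)
    (h : 0 ≤ meromorphicOrderAt f z) : 0 ≤ meromorphicOrderAt (fun w ↦ k * f w + h₀) z :=
  le_trans (le_min (meromorphicOrderAt_const_mul_nonneg hf h k)
    (AnalyticAt.meromorphicOrderAt_nonneg (f := fun _ ↦ h₀) analyticAt_const))
    (meromorphicOrderAt_add (by fun_prop) (by fun_prop))

lemma finsum_mem_eq_finset_sum {D : Set ℂ} {m : ℂ → ℕ} (S : Finset ℂ) (hS : ↑S ⊆ D)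
    (h : ∀ z ∈ D, z ∉ S → m z = 0) : ∑ᶠ z ∈ D, m z = ∑ z ∈ S, m z := by
  rw [← finsum_mem_coe_finset, ← finsum_mem_inter_support m D, ← finsum_mem_inter_support m ↑S]
  suffices D ∩ Function.support m = ↑S ∩ Function.support m by rw [this]
  ext z
  constructor
  · rintro ⟨hz, hm⟩
    exact ⟨by_contra fun hzS ↦ hm (h z hz hzS), hm⟩
  · exact fun ⟨hz, hm⟩ ↦ ⟨hS hz, hm⟩

/-- A `finsum` with infinite support is `0` by convention, so a nonzero pole count already contains
the finiteness of the set of poles. -/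
lemma exists_finset_of_finsum_mem_ne_zero {D : Set ℂ} {m : ℂ → ℕ} (h : ∑ᶠ z ∈ D, m z ≠ 0) :
    ∃ S : Finset ℂ, (∀ z, z ∈ S ↔ z ∈ D ∧ m z ≠ 0) ∧ ∑ z ∈ S, m z = ∑ᶠ z ∈ D, m z := by
  have hfin : (D ∩ Function.support m).Finite := by
    by_contra hinf
    exact h (finsum_mem_eq_zero_of_infinite hinf)
  have hS : ∀ z, z ∈ hfin.toFinset ↔ z ∈ D ∧ m z ≠ 0 := by simp
  refine ⟨hfin.toFinset, hS, (finsum_mem_eq_finset_sum _ (fun z hz ↦ ((hS z).1 hz).1) ?_).symm⟩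
  intro z hz hzS
  by_contra hm
  exact hzS ((hS z).2 ⟨hz, hm⟩)

lemma eq_two_of_finsum_mem_eq_two {D : Set ℂ} {m : ℂ → ℕ} (h : ∑ᶠ z ∈ D, m z = 2) {a : ℂ}
    (ha : a ∈ D) (hm : 2 ≤ m a) : m a = 2 ∧ ∀ z ∈ D, z ≠ a → m z = 0 := by
  obtain ⟨S, hS, hsum⟩ := exists_finset_of_finsum_mem_ne_zero (m := m) (D := D) (by omega)
  have haS : a ∈ S := (hS a).2 ⟨ha, by omega⟩
  rw [h, ← Finset.add_sum_erase S m haS] at hsum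
  refine ⟨by omega, fun z hz hza ↦ ?_⟩
  by_contra hmz
  have h1 : z ∈ S.erase a := Finset.mem_erase.2 ⟨hza, (hS z).2 ⟨hz, hmz⟩⟩
  have := Finset.single_le_sum (f := m) (fun _ _ ↦ Nat.zero_le _) h1
  omega

lemma exists_two_of_finsum_mem_eq_two {D : Set ℂ} {m : ℂ → ℕ} (h : ∑ᶠ z ∈ D, m z = 2)
    (hm : ∀ z, m z ≤ 1) :
    ∃ a ∈ D, ∃ b ∈ D, a ≠ b ∧ ∀ z ∈ D, z ≠ a → z ≠ b → m z = 0 := by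
  obtain ⟨S, hS, hsum⟩ := exists_finset_of_finsum_mem_ne_zero (m := m) (D := D) (by omega)
  have hcard : S.card = 2 := by
    rw [← h, ← hsum, Finset.card_eq_sum_ones]
    refine Finset.sum_congr rfl fun z hz ↦ ?_
    have := ((hS z).1 hz).2
    have := hm z
    omega
  obtain ⟨a, b, hab, rfl⟩ := Finset.card_eq_two.1 hcard
  refine ⟨a, ((hS a).1 (by simp)).1, b, ((hS b).1 (by simp)).1, hab, fun z hz h1 h2 ↦ ?_⟩
  by_contra hmz
  simpa [h1, h2] using (hS z).2 ⟨hz, hmz⟩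

namespace PeriodPair

variable {L : PeriodPair}

lemma exists_mem_fundamentalDomain (L : PeriodPair) (x : ℂ) :
    ∃ r ∈ ZSpan.fundamentalDomain L.basis, r - x ∈ L.lattice := by
  obtain ⟨v, hv, -⟩ := ZSpan.exist_unique_vadd_mem_fundamentalDomain L.basis x
  refine ⟨_, hv, ?_⟩
  rw [L.lattice_eq_span_range_basis]
  simp [Submodule.vadd_def]

lemma eq_of_mem_fundamentalDomain {x y : ℂ} (hx : x ∈ ZSpan.fundamentalDomain L.basis)
    (hy : y ∈ ZSpan.fundamentalDomain L.basis) (h : x - y ∈ L.lattice) : x = y := by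
  obtain ⟨v, hv, huniq⟩ := ZSpan.exist_unique_vadd_mem_fundamentalDomain L.basis y
  rw [L.lattice_eq_span_range_basis] at h
  have h1 := huniq 0 (by simpa using hy)
  have h2 := huniq ⟨_, h⟩ (by simpa [Submodule.vadd_def] using hx)
  have h3 := congrArg Subtype.val (h2.trans h1.symm)
  exact sub_eq_zero.1 h3

lemma IsElliptic.poleMultiplicity_eq {w : ℂ → ℂ} (hw : L.IsElliptic w) {x y : ℂ}
    (h : x - y ∈ L.lattice) : poleMultiplicity w x = poleMultiplicity w y := by
  rw [poleMultiplicity, poleMultiplicity, hw.order_eq_of_sub_mem h]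

end PeriodPair

lemma IsEllipticOfOrder.isElliptic {L : PeriodPair} {n : ℕ} {w : ℂ → ℂ}
    (hw : IsEllipticOfOrder L n w) : L.IsElliptic w :=
  ⟨hw.1, fun l hl ↦ (hw.2.1 l).1 hl⟩

lemma IsEllipticOfOrder.congr {L : PeriodPair} {n : ℕ} {w v : ℂ → ℂ}
    (hw : IsEllipticOfOrder L n w) (h : w =ᶠ[codiscrete ℂ] v) : IsEllipticOfOrder L n v := by
  refine ⟨hw.1.congr_codiscrete h, fun l ↦ (hw.2.1 l).trans ?_, ?_⟩
  · have h' := (tendsto_add_const_codiscrete l).eventually h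
    exact ⟨fun h1 ↦ by filter_upwards [h, h', h1] with z e1 e2 e3 using by rw [← e1, ← e2, e3],
      fun h1 ↦ by filter_upwards [h, h', h1] with z e1 e2 e3 using by rw [e1, e2, e3]⟩
  · rw [← hw.2.2]
    exact finsum_congr fun z ↦ by rw [poleMultiplicity_congr h]

/-- An elliptic function of order two with simple poles is a Möbius image of `addQuotient`. -/
theorem IsEllipticOfOrder.eq_addQuotient {L : PeriodPair} {w : ℂ → ℂ}
    (hw : IsEllipticOfOrder L 2 w) (h1 : ∀ z, poleMultiplicity w z ≤ 1) :
    ∃ u ∉ L.lattice, ∃ k h₀ t₀, w =ᶠ[codiscrete ℂ] fun z ↦ k * L.addQuotient (L.weierstrassP u)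
      (L.derivWeierstrassP u) (z - t₀) + h₀ := by
  obtain ⟨a, ha, b, hb, hab, hz⟩ := exists_two_of_finsum_mem_eq_two hw.2.2 h1
  have hel := hw.isElliptic
  have hba : b - a ∉ L.lattice := fun h ↦ hab (L.eq_of_mem_fundamentalDomain hb ha h).symm
  have h2 : ∀ z, -1 ≤ meromorphicOrderAt w z := fun z ↦ by
    simpa using neg_le_order_of_poleMultiplicity_le (h1 z)
  obtain ⟨k, h₀, h⟩ := hel.eq_addQuotient hba (h2 a) (h2 b) fun z hza hzb ↦ by
    obtain ⟨r, hr, hrz⟩ := L.exists_mem_fundamentalDomain z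
    rw [← hel.order_eq_of_sub_mem hrz]
    refine order_nonneg_of_poleMultiplicity_eq_zero (hz r hr ?_ ?_)
    · rintro rfl; exact hza (by simpa using neg_mem hrz)
    · rintro rfl; exact hzb (by simpa using neg_mem hrz)
  exact ⟨b - a, hba, k, h₀, a, h⟩

/-- An elliptic function of order two with a double pole is an affine image of `℘`. -/
theorem IsEllipticOfOrder.eq_weierstrassP {L : PeriodPair} {w : ℂ → ℂ}
    (hw : IsEllipticOfOrder L 2 w) (h1 : ∃ z, 2 ≤ poleMultiplicity w z) :
    ∃ k h₀ t₀, w =ᶠ[codiscrete ℂ] fun z ↦ k * L.weierstrassP (z - t₀) + h₀ := by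
  obtain ⟨x, hx⟩ := h1
  have hel := hw.isElliptic
  obtain ⟨a, ha, hax⟩ := L.exists_mem_fundamentalDomain x
  rw [← hel.poleMultiplicity_eq hax] at hx
  obtain ⟨h2, hz⟩ := eq_two_of_finsum_mem_eq_two hw.2.2 ha hx
  obtain ⟨k, h₀, h⟩ := hel.eq_weierstrassP (a := a)
    (by simpa using neg_le_order_of_poleMultiplicity_le h2.le) fun z hza ↦ by
      obtain ⟨r, hr, hrz⟩ := L.exists_mem_fundamentalDomain z
      rw [← hel.order_eq_of_sub_mem hrz]
      refine order_nonneg_of_poleMultiplicity_eq_zero (hz r hr ?_)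
      rintro rfl; exact hza (by simpa using neg_mem hrz)
  exact ⟨k, h₀, a, h⟩

/-- A nonconstant function has a pole, so the linear coefficient of an affine image is nonzero. -/
lemma IsEllipticOfOrder.not_eventuallyEq_const {L : PeriodPair} {w : ℂ → ℂ}
    (hw : IsEllipticOfOrder L 2 w) (c : ℂ) : ¬ w =ᶠ[codiscrete ℂ] fun _ ↦ c := fun h ↦ by
  have h1 := hw.2.2
  have h2 : ∀ z, poleMultiplicity w z = 0 := fun z ↦ by
    rw [poleMultiplicity_congr h]
    exact poleMultiplicity_eq_zero (AnalyticAt.meromorphicOrderAt_nonneg analyticAt_const)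
  simp [h2] at h1

namespace PeriodPair

variable (L : PeriodPair)

lemma poleMultiplicity_addQuotient {u : ℂ} (hu : u ∉ L.lattice) {k : ℂ} (hk : k ≠ 0) (h₀ t₀ z : ℂ) :
    (z - t₀ ∈ L.lattice ∨ z - (t₀ + u) ∈ L.lattice → poleMultiplicity (fun z ↦ k * L.addQuotient
      (L.weierstrassP u) (L.derivWeierstrassP u) (z - t₀) + h₀) z = 1) ∧
    (z - t₀ ∉ L.lattice → z - (t₀ + u) ∉ L.lattice → poleMultiplicity (fun z ↦ k * L.addQuotient
      (L.weierstrassP u) (L.derivWeierstrassP u) (z - t₀) + h₀) z = 0) := by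
  set φ := L.addQuotient (L.weierstrassP u) (L.derivWeierstrassP u) with hφ
  have hsub : z - (t₀ + u) = z - t₀ - u := by ring
  rw [hsub]
  have ho : meromorphicOrderAt (fun z ↦ φ (z - t₀)) z = meromorphicOrderAt φ (z - t₀) :=
    meromorphicOrderAt_comp_sub_const φ t₀ z
  have hpole : meromorphicOrderAt φ (z - t₀) = -1 →
      poleMultiplicity (fun z ↦ k * φ (z - t₀) + h₀) z = 1 := fun h ↦ by
    rw [← ho] at h
    apply poleMultiplicity_of_order_eq
    rw [order_const_mul_add_of_neg hk h₀ (by rw [h]; decide), h]; rfl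
  refine ⟨fun h ↦ ?_, fun h1 h2 ↦ ?_⟩
  · by_cases hz : z - t₀ ∈ L.lattice
    · exact hpole (L.order_addQuotient_of_mem _ _ hz)
    · exact hpole ((L.order_addQuotient_of_notMem hu hz).1 (h.resolve_left hz))
  · refine poleMultiplicity_eq_zero (order_const_mul_add_nonneg
      (((L.isElliptic_addQuotient _ _).comp_sub_const t₀).meromorphic z) _ _ ?_)
    rw [ho]
    exact (L.order_addQuotient_of_notMem hu h1).2 h2

lemma poleMultiplicity_weierstrassP {k : ℂ} (hk : k ≠ 0) (h₀ t₀ z : ℂ) :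
    (z - t₀ ∈ L.lattice → poleMultiplicity (fun z ↦ k * L.weierstrassP (z - t₀) + h₀) z = 2) ∧
    (z - t₀ ∉ L.lattice → poleMultiplicity (fun z ↦ k * L.weierstrassP (z - t₀) + h₀) z = 0) := by
  have ho : meromorphicOrderAt (fun z ↦ L.weierstrassP (z - t₀)) z
      = meromorphicOrderAt L.weierstrassP (z - t₀) :=
    meromorphicOrderAt_comp_sub_const L.weierstrassP t₀ z
  refine ⟨fun h ↦ ?_, fun h ↦ ?_⟩
  · rw [L.order_weierstrassP _ h] at ho
    apply poleMultiplicity_of_order_eq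
    rw [order_const_mul_add_of_neg hk h₀ (by rw [ho]; decide), ho]; rfl
  · refine poleMultiplicity_eq_zero (order_const_mul_add_nonneg
      ((L.isElliptic_weierstrassP.comp_sub_const t₀).meromorphic z) _ _ ?_)
    rw [ho]
    exact (L.analyticAt_weierstrassP h).meromorphicOrderAt_nonneg

variable {L}

/-- A period of an affine image is a period of the function. -/
lemma eventuallyEq_of_affine_comp_sub {f : ℂ → ℂ} {k h₀ t₀ l : ℂ} (hk : k ≠ 0)
    (h : (fun z ↦ k * f (z + l - t₀) + h₀) =ᶠ[codiscrete ℂ] fun z ↦ k * f (z - t₀) + h₀) :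
    (fun z ↦ f (z + l)) =ᶠ[codiscrete ℂ] f := by
  filter_upwards [(tendsto_add_const_codiscrete t₀).eventually h] with z hz
  rw [add_sub_cancel_right, show z + t₀ + l - t₀ = z + l by ring] at hz
  exact mul_left_cancel₀ hk (add_right_cancel hz)

/-- The point needing care is that there are no periods outside the lattice: a period of `φ` is one
of `φ'`, hence of `℘ = (φ' + φ² - A) / 2`. The poles are the classes of `t₀` and `t₀ + u`, distinct
since `u` is not in the lattice. -/
theorem isEllipticOfOrder_addQuotient {u : ℂ} (hu : u ∉ L.lattice) {k : ℂ} (hk : k ≠ 0)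
    (h₀ t₀ : ℂ) : IsEllipticOfOrder L 2 fun z ↦ k * L.addQuotient (L.weierstrassP u)
      (L.derivWeierstrassP u) (z - t₀) + h₀ := by
  have hel := L.isElliptic_addQuotient (L.weierstrassP u) (L.derivWeierstrassP u)
  have hel' := ((hel.comp_sub_const t₀).const_mul k).add (.const h₀)
  refine ⟨hel'.meromorphic, fun l ↦ ⟨hel'.periodic l, fun h ↦ ?_⟩, ?_⟩
  · have hφ := eventuallyEq_of_affine_comp_sub hk h
    have hd := deriv_eventuallyEq_codiscrete hφ
    have hreg := eventually_regular (L := L) (L.weierstrassP u)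
    apply L.mem_lattice_of_weierstrassP_periodic
    filter_upwards [hφ, hd, hreg, (tendsto_add_const_codiscrete l).eventually hreg]
      with z e1 e2 e3 e4
    have hB := L.derivWeierstrassP_sq u hu
    rw [deriv_comp_add_const, (hasDerivAt_addQuotient hB e3.1 e3.2).deriv,
      (hasDerivAt_addQuotient hB e4.1 e4.2).deriv, e1] at e2
    linear_combination e2 / 2
  · obtain ⟨r, hr, hrz⟩ := L.exists_mem_fundamentalDomain t₀
    obtain ⟨s, hs, hsz⟩ := L.exists_mem_fundamentalDomain (t₀ + u)
    have hrs : r ≠ s := by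
      rintro rfl
      exact hu (by convert sub_mem hrz hsz using 1; ring)
    rw [finsum_mem_eq_finset_sum {r, s} (by simp [Set.insert_subset_iff, hr, hs]),
      Finset.sum_pair hrs, (L.poleMultiplicity_addQuotient hu hk h₀ t₀ r).1 (.inl hrz),
      (L.poleMultiplicity_addQuotient hu hk h₀ t₀ s).1 (.inr hsz)]
    intro z hz hzS
    simp only [Finset.mem_insert, Finset.mem_singleton, not_or] at hzS
    refine (L.poleMultiplicity_addQuotient hu hk h₀ t₀ z).2 (fun h ↦ hzS.1 ?_) fun h ↦ hzS.2 ?_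
    · exact L.eq_of_mem_fundamentalDomain hz hr (by convert sub_mem h hrz using 1; ring)
    · exact L.eq_of_mem_fundamentalDomain hz hs (by convert sub_mem h hsz using 1; ring)

theorem isEllipticOfOrder_weierstrassP {k : ℂ} (hk : k ≠ 0)
    (h₀ t₀ : ℂ) : IsEllipticOfOrder L 2 fun z ↦ k * L.weierstrassP (z - t₀) + h₀ := by
  have hel' := ((L.isElliptic_weierstrassP.comp_sub_const t₀).const_mul k).add (.const h₀)
  refine ⟨hel'.meromorphic, fun l ↦ ⟨hel'.periodic l, fun h ↦
    L.mem_lattice_of_weierstrassP_periodic (eventuallyEq_of_affine_comp_sub hk h)⟩, ?_⟩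
  obtain ⟨r, hr, hrz⟩ := L.exists_mem_fundamentalDomain t₀
  rw [finsum_mem_eq_finset_sum {r} (by simp [hr]), Finset.sum_singleton,
    (L.poleMultiplicity_weierstrassP hk h₀ t₀ r).1 hrz]
  intro z hz hzS
  refine (L.poleMultiplicity_weierstrassP hk h₀ t₀ z).2 fun h ↦ hzS (Finset.mem_singleton.2 ?_)
  exact L.eq_of_mem_fundamentalDomain hz hr (by convert sub_mem h hrz using 1; ring)

end PeriodPair

/-! ### Reduction of the differential equation to polynomial identities -/

namespace DHCoeffs

lemma lhs_congr (p : DHCoeffs) {w v : ℂ → ℂ} {t : ℂ} (h : w =ᶠ[𝓝 t] v) :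
    p.lhs w t = p.lhs v t := by
  simp only [lhs, h.eq_of_nhds, h.deriv_eq, h.iteratedDeriv_eq]

lemma analyticAt_lhs (p : DHCoeffs) {w : ℂ → ℂ} {t : ℂ} (h : AnalyticAt ℂ w t) :
    AnalyticAt ℂ (p.lhs w) t := by
  have h1 := h.deriv
  have h2 : AnalyticAt ℂ (iteratedDeriv 2 w) t := by
    rw [iteratedDeriv_eq_iterate]; exact h.iterated_deriv 2
  have h3 : AnalyticAt ℂ (iteratedDeriv 3 w) t := by
    rw [iteratedDeriv_eq_iterate]; exact h.iterated_deriv 3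
  unfold lhs
  fun_prop

/-- This lets the equation be checked on an explicit representative off a discrete set. Where `w` is
analytic the left-hand side is continuous, so exceptional points are reached as limits. -/
lemma isSolution_iff (p : DHCoeffs) {w v : ℂ → ℂ} (hw : Meromorphic w)
    (h : w =ᶠ[codiscrete ℂ] v) : p.IsSolution w ↔ ∀ᶠ t in codiscrete ℂ, p.lhs v t = 0 := by
  constructor
  · intro hs
    filter_upwards [eventually_codiscrete_analyticAt hw, eventually_codiscrete_eventuallyEq_nhds h]
      with t h1 h2
    rw [← p.lhs_congr h2, hs t h1]
  · intro hs t ht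
    have h1 : ∀ᶠ s in 𝓝[≠] t, p.lhs w s = 0 := by
      refine eventually_codiscrete_iff_nhdsNE.1 ?_ t
      filter_upwards [hs, eventually_codiscrete_eventuallyEq_nhds h] with s h1 h2
      rw [p.lhs_congr h2, h1]
    have h2 := (p.analyticAt_lhs ht).continuousAt.tendsto.mono_left
      (nhdsWithin_le_nhds (s := {t}ᶜ))
    exact tendsto_nhds_unique_of_eventuallyEq h2 tendsto_const_nhds h1

lemma lhs_normalize (p : DHCoeffs) (hγ : p.γ₁ ≠ 0) (w : ℂ → ℂ) (t : ℂ) :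
    p.lhs w t = p.γ₁ * p.normalize.lhs w t := by
  simp only [lhs, normalize]
  field_simp

lemma isSolution_normalize (p : DHCoeffs) (hγ : p.γ₁ ≠ 0) (w : ℂ → ℂ) :
    p.normalize.IsSolution w ↔ p.IsSolution w := by
  simp [IsSolution, p.lhs_normalize hγ, hγ]

/-- The equation for an affine image of a function with known derivatives. -/
lemma lhs_affine (p : DHCoeffs) {f f₁ f₂ f₃ : ℂ → ℂ} (k h₀ t₀ t : ℂ)
    (h : ∀ᶠ s in 𝓝 (t - t₀), HasDerivAt f (f₁ s) s ∧ HasDerivAt f₁ (f₂ s) s ∧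
      HasDerivAt f₂ (f₃ s) s) :
    p.lhs (fun t ↦ k * f (t - t₀) + h₀) t = p.γ₁ * (k * f₃ (t - t₀))
      + (p.δ₁ * (k * f (t - t₀) + h₀) + p.δ₅) * (k * f₂ (t - t₀))
      + p.δ₂ * (k * f₁ (t - t₀)) ^ 2 + (p.δ₃ * (k * f (t - t₀) + h₀) ^ 2
        + p.δ₆ * (k * f (t - t₀) + h₀) + p.δ₇) * (k * f₁ (t - t₀))
      + p.δ₄ * (k * f (t - t₀) + h₀) ^ 4 + p.δ₈ * (k * f (t - t₀) + h₀) ^ 3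
      + p.δ₉ * (k * f (t - t₀) + h₀) ^ 2 + p.δ₁₀ * (k * f (t - t₀) + h₀) + p.δ₁₁ := by
  have h' : ∀ᶠ s in 𝓝 t, HasDerivAt f (f₁ (s - t₀)) (s - t₀) ∧
      HasDerivAt f₁ (f₂ (s - t₀)) (s - t₀) ∧ HasDerivAt f₂ (f₃ (s - t₀)) (s - t₀) :=
    ((continuous_sub_right t₀).continuousAt (x := t)).eventually h
  have e1 : deriv (fun t ↦ k * f (t - t₀) + h₀) =ᶠ[𝓝 t] fun t ↦ k * f₁ (t - t₀) :=
    h'.mono fun s hs ↦ ((hs.1.comp_sub_const s t₀).const_mul k |>.add_const h₀).deriv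
  have e2 : iteratedDeriv 2 (fun t ↦ k * f (t - t₀) + h₀) =ᶠ[𝓝 t] fun t ↦ k * f₂ (t - t₀) := by
    rw [iteratedDeriv_succ, iteratedDeriv_one]
    exact e1.deriv.trans (h'.mono fun s hs ↦ ((hs.2.1.comp_sub_const s t₀).const_mul k).deriv)
  have e3 : iteratedDeriv 3 (fun t ↦ k * f (t - t₀) + h₀) =ᶠ[𝓝 t] fun t ↦ k * f₃ (t - t₀) := by
    rw [iteratedDeriv_succ]
    exact e2.deriv.trans (h'.mono fun s hs ↦ ((hs.2.2.comp_sub_const s t₀).const_mul k).deriv)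
  rw [lhs, e1.eq_of_nhds, e2.eq_of_nhds, e3.eq_of_nhds]

/-- The coefficient equations for `w = h₀ - c φ`, where `φ` has two simple poles. -/
def SimplePoleEquations (q : DHCoeffs) (c h₀ A B g₂ : ℂ) : Prop :=
  (-6 - q.δ₃ * c ^ 2 = 0 ∧ 2 * q.δ₃ * h₀ + q.δ₆ = 0 ∧
    6 * A - q.δ₃ * h₀ ^ 2 - q.δ₆ * h₀ - q.δ₇ = 0) ∧
  2 * q.δ₁ + q.δ₂ + q.δ₄ * c ^ 2 = 0 ∧
  -2 * (q.δ₁ * h₀ + q.δ₅) - 4 * q.δ₄ * h₀ * c ^ 2 - q.δ₈ * c ^ 2 = 0 ∧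
  -6 * A * (q.δ₁ + q.δ₂) + 6 * q.δ₄ * h₀ ^ 2 + 3 * q.δ₈ * h₀ + q.δ₉ = 0 ∧
  6 * A * (q.δ₁ * h₀ + q.δ₅) - 2 * B * c * (q.δ₁ + 2 * q.δ₂) - 4 * q.δ₄ * h₀ ^ 3
    - 3 * q.δ₈ * h₀ ^ 2 - 2 * q.δ₉ * h₀ - q.δ₁₀ = 0 ∧
  2 * B * c * (q.δ₁ * h₀ + q.δ₅) + q.δ₂ * c ^ 2 * (g₂ - 3 * A ^ 2) + q.δ₄ * h₀ ^ 4
    + q.δ₈ * h₀ ^ 3 + q.δ₉ * h₀ ^ 2 + q.δ₁₀ * h₀ + q.δ₁₁ = 0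

/-- The coefficient equations for `w = c ℘ + h₀`. -/
def DoublePoleEquations (q : DHCoeffs) (c h₀ g₂ g₃ : ℂ) : Prop :=
  (q.δ₃ = 0 ∧ 12 + 2 * q.δ₃ * c * h₀ + q.δ₆ * c = 0 ∧
    q.δ₃ * h₀ ^ 2 + q.δ₆ * h₀ + q.δ₇ = 0) ∧
  q.δ₄ = 0 ∧
  6 * q.δ₁ + 4 * q.δ₂ + 4 * q.δ₄ * c * h₀ + q.δ₈ * c = 0 ∧
  6 * (q.δ₁ * h₀ + q.δ₅) + 6 * q.δ₄ * c * h₀ ^ 2 + 3 * q.δ₈ * c * h₀ + q.δ₉ * c = 0 ∧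
  -c * q.δ₁ * g₂ / 2 - q.δ₂ * c * g₂ + 4 * q.δ₄ * h₀ ^ 3 + 3 * q.δ₈ * h₀ ^ 2
    + 2 * q.δ₉ * h₀ + q.δ₁₀ = 0 ∧
  -(q.δ₁ * h₀ + q.δ₅) * c * g₂ / 2 - q.δ₂ * c ^ 2 * g₃ + q.δ₄ * h₀ ^ 4 + q.δ₈ * h₀ ^ 3
    + q.δ₉ * h₀ ^ 2 + q.δ₁₀ * h₀ + q.δ₁₁ = 0

end DHCoeffs

/-! ### Comparing coefficients, and the identity `P² = Q² R` -/

section Polynomials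

open Polynomial

lemma quadratic_coeffs_eq_zero {a₂ a₁ a₀ : ℂ} (h : (C a₂ * X ^ 2 + C a₁ * X + C a₀ : ℂ[X]) = 0) :
    a₂ = 0 ∧ a₁ = 0 ∧ a₀ = 0 := by
  refine ⟨?_, ?_, ?_⟩
  · simpa [coeff_X, coeff_C] using congrArg (coeff · 2) h
  · simpa [coeff_X, coeff_C] using congrArg (coeff · 1) h
  · simpa [coeff_X, coeff_C] using congrArg (coeff · 0) h

lemma quartic_coeffs_eq_zero {a₄ a₃ a₂ a₁ a₀ : ℂ}
    (h : (C a₄ * X ^ 4 + C a₃ * X ^ 3 + C a₂ * X ^ 2 + C a₁ * X + C a₀ : ℂ[X]) = 0) :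
    a₄ = 0 ∧ a₃ = 0 ∧ a₂ = 0 ∧ a₁ = 0 ∧ a₀ = 0 := by
  refine ⟨?_, ?_, ?_, ?_, ?_⟩
  · simpa [coeff_X, coeff_C, coeff_X_pow] using congrArg (coeff · 4) h
  · simpa [coeff_X, coeff_C, coeff_X_pow] using congrArg (coeff · 3) h
  · simpa [coeff_X, coeff_C, coeff_X_pow] using congrArg (coeff · 2) h
  · simpa [coeff_X, coeff_C, coeff_X_pow] using congrArg (coeff · 1) h
  · simpa [coeff_X, coeff_C, coeff_X_pow] using congrArg (coeff · 0) h

/-- A monic quartic without cubic term which is a square is the square of `X² + r₂ / 2`. -/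
lemma quartic_of_eq_sq {r₂ r₁ r₀ : ℂ} {S : ℂ[X]}
    (h : X ^ 4 + C r₂ * X ^ 2 + C r₁ * X + C r₀ = S ^ 2) : r₁ = 0 ∧ 4 * r₀ = r₂ ^ 2 := by
  have hdeg : (X ^ 4 + C r₂ * X ^ 2 + C r₁ * X + C r₀ : ℂ[X]).natDegree = 4 := by
    compute_degree!
  rw [h, natDegree_pow] at hdeg
  have hS : S.natDegree = 2 := by omega
  have hS' : S = C (S.coeff 2) * X ^ 2 + C (S.coeff 1) * X + C (S.coeff 0) := by
    conv_lhs => rw [S.as_sum_range_C_mul_X_pow, hS]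
    simp [Finset.sum_range_succ]
    ring
  set a := S.coeff 2
  set b := S.coeff 1
  set c := S.coeff 0
  have h0 : (C (1 - a ^ 2) * X ^ 4 + C (-(2 * a * b)) * X ^ 3 + C (r₂ - (2 * a * c + b ^ 2)) * X ^ 2
      + C (r₁ - 2 * b * c) * X + C (r₀ - c ^ 2) : ℂ[X]) = 0 := by
    rw [hS'] at h
    simp only [map_sub, map_neg, map_mul, map_pow, map_add, map_one, map_ofNat]
    linear_combination h
  obtain ⟨h4, h3, h2, h1, h0⟩ := quartic_coeffs_eq_zero h0
  have ha : a ≠ 0 := fun ha ↦ by simp [ha] at h4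
  have hb : b = 0 := by simpa [ha] using h3
  rw [hb] at h1 h2
  refine ⟨by linear_combination h1, ?_⟩
  linear_combination 4 * h0 - (r₂ + 2 * a * c) * h2 + 4 * c ^ 2 * h4

/-- If `Q ≠ 0`, then `Q² ∣ P²` gives `Q ∣ P` because `ℂ[X]` is integrally closed, and cancelling
`Q²` exhibits the quartic as a square. -/
lemma eq_zero_of_sq_eq_sq_mul_quartic {P Q : ℂ[X]} {r₂ r₁ r₀ : ℂ}
    (h : P ^ 2 = Q ^ 2 * (X ^ 4 + C r₂ * X ^ 2 + C r₁ * X + C r₀))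
    (hr : ¬ (r₁ = 0 ∧ 4 * r₀ = r₂ ^ 2)) : P = 0 ∧ Q = 0 := by
  by_cases hQ : Q = 0
  · rw [hQ] at h
    exact ⟨by simpa using h, hQ⟩
  · exfalso
    obtain ⟨S, rfl⟩ : Q ∣ P := (IsIntegrallyClosed.pow_dvd_pow_iff two_ne_zero).1 ⟨_, h⟩
    rw [mul_pow] at h
    exact hr (quartic_of_eq_sq (mul_left_cancel₀ (pow_ne_zero 2 hQ) h).symm)

end Polynomials

/-! ### Substituting the normal forms into the equation -/

namespace PeriodPair

variable {L : PeriodPair}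

/-- The quartic of the differential equation for `addQuotient` is not a square. -/
lemma quartic_not_square {A B : ℂ} (hB : B ^ 2 = 4 * A ^ 3 - L.g₂ * A - L.g₃) :
    ¬ (-4 * B = 0 ∧ 4 * (L.g₂ - 3 * A ^ 2) = (-6 * A) ^ 2) := by
  rintro ⟨h1, h2⟩
  have hB0 : B = 0 := by simpa using h1
  have hg2 : L.g₂ = 12 * A ^ 2 := by linear_combination h2 / 4
  have hg3 : L.g₃ = -8 * A ^ 3 := by rw [hB0, hg2] at hB; linear_combination hB
  obtain ⟨e₁, e₂, e₃, h12, h13, h23, he⟩ := L.exists_distinct_roots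
  -- For these invariants the cubic is `4 (X - A)² (X + 2A)`, which cannot have three distinct
  -- roots.
  have key : ∀ e ∈ ({e₁, e₂, e₃} : Set ℂ), e = A ∨ e = -2 * A := fun e hm ↦ by
    have h3 := he e hm
    rw [hg2, hg3] at h3
    have h4 : (e - A) ^ 2 * (e - -2 * A) = 0 := by linear_combination h3 / 4
    rcases mul_eq_zero.1 h4 with h5 | h5
    · exact .inl (sub_eq_zero.1 (pow_eq_zero_iff two_ne_zero |>.1 h5))
    · exact .inr (sub_eq_zero.1 h5)
  have r1 := key e₁ (by simp)
  have r2 := key e₂ (by simp)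
  have r3 := key e₃ (by simp)
  rcases r1 with r1 | r1 <;> rcases r2 with r2 | r2 <;> rcases r3 with r3 | r3 <;> simp_all

lemma eventually_nhds_regular {a z : ℂ} (hz : z ∉ L.lattice) (ha : L.weierstrassP z ≠ a) :
    ∀ᶠ s in 𝓝 z, s ∉ L.lattice ∧ L.weierstrassP s ≠ a :=
  (L.eventually_nhds_notMem_lattice hz).and
    ((L.analyticAt_weierstrassP hz).continuousAt.eventually_ne ha)

/-- The shape is `P(φ) + Q(φ) φ'`, with `φ'` written as `2℘ + A - φ²`: the derivatives `φ''` and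
`φ'²` are polynomials in `φ`, and `φ'''` is a polynomial times `φ'`. -/
lemma lhs_addQuotient {A B : ℂ} (hB : B ^ 2 = 4 * A ^ 3 - L.g₂ * A - L.g₃) (q : DHCoeffs)
    (hq : q.γ₁ = 1) (c h₀ t₀ : ℂ) {t : ℂ} (ht : t - t₀ ∉ L.lattice)
    (hA : L.weierstrassP (t - t₀) ≠ A) :
    q.lhs (fun t ↦ -c * L.addQuotient A B (t - t₀) + h₀) t =
      (c ^ 2 * (2 * q.δ₁ + q.δ₂ + q.δ₄ * c ^ 2)) * L.addQuotient A B (t - t₀) ^ 4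
      + (c * (-2 * (q.δ₁ * h₀ + q.δ₅) - 4 * q.δ₄ * h₀ * c ^ 2 - q.δ₈ * c ^ 2)) *
        L.addQuotient A B (t - t₀) ^ 3
      + (c ^ 2 * (-6 * A * (q.δ₁ + q.δ₂) + 6 * q.δ₄ * h₀ ^ 2 + 3 * q.δ₈ * h₀ + q.δ₉)) *
        L.addQuotient A B (t - t₀) ^ 2
      + (c * (6 * A * (q.δ₁ * h₀ + q.δ₅) - 2 * B * c * (q.δ₁ + 2 * q.δ₂) - 4 * q.δ₄ * h₀ ^ 3
        - 3 * q.δ₈ * h₀ ^ 2 - 2 * q.δ₉ * h₀ - q.δ₁₀)) * L.addQuotient A B (t - t₀)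
      + (2 * B * c * (q.δ₁ * h₀ + q.δ₅) + q.δ₂ * c ^ 2 * (L.g₂ - 3 * A ^ 2) + q.δ₄ * h₀ ^ 4
        + q.δ₈ * h₀ ^ 3 + q.δ₉ * h₀ ^ 2 + q.δ₁₀ * h₀ + q.δ₁₁)
      + ((c * (-6 - q.δ₃ * c ^ 2)) * L.addQuotient A B (t - t₀) ^ 2
        + (c ^ 2 * (2 * q.δ₃ * h₀ + q.δ₆)) * L.addQuotient A B (t - t₀)
        + c * (6 * A - q.δ₃ * h₀ ^ 2 - q.δ₆ * h₀ - q.δ₇)) *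
        (2 * L.weierstrassP (t - t₀) + A - L.addQuotient A B (t - t₀) ^ 2) := by
  rw [q.lhs_affine (f := L.addQuotient A B)
    (f₁ := fun z ↦ 2 * L.weierstrassP z + A - L.addQuotient A B z ^ 2)
    (f₂ := fun z ↦ 2 * L.addQuotient A B z ^ 3 - 6 * A * L.addQuotient A B z - 2 * B)
    (f₃ := fun z ↦ (6 * L.addQuotient A B z ^ 2 - 6 * A) *
      (2 * L.weierstrassP z + A - L.addQuotient A B z ^ 2))]
  · have h1 := addQuotient_deriv_sq hB ht hA
    rw [hq]
    linear_combination q.δ₂ * c ^ 2 * h1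
  · filter_upwards [eventually_nhds_regular ht hA] with s hs
    have h1 := hasDerivAt_addQuotient hB hs.1 hs.2
    refine ⟨h1, hasDerivAt_deriv_addQuotient hB hs.1 hs.2, ?_⟩
    refine ((((h1.fun_pow 3).const_mul 2).sub (h1.const_mul (6 * A))).sub_const _).congr_deriv ?_
    norm_num
    ring

/-- The differential equation for an affine image of `addQuotient`. -/
theorem isSolution_addQuotient_iff {A B : ℂ} (hB : B ^ 2 = 4 * A ^ 3 - L.g₂ * A - L.g₃)
    (q : DHCoeffs) (hq : q.γ₁ = 1) {c : ℂ} (hc : c ≠ 0) (h₀ t₀ : ℂ) {w : ℂ → ℂ}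
    (hw : w =ᶠ[codiscrete ℂ] fun t ↦ -c * L.addQuotient A B (t - t₀) + h₀) :
    q.IsSolution w ↔ q.SimplePoleEquations c h₀ A B L.g₂ := by
  have hφ := L.isElliptic_addQuotient A B
  have hmer : Meromorphic w :=
    (((hφ.comp_sub_const t₀).const_mul (-c)).add (.const h₀)).meromorphic.congr_codiscrete hw.symm
  rw [q.isSolution_iff hmer hw]
  have hreg := eventually_regular (L := L) A
  constructor
  · intro h
    have h1 : ∀ᶠ s in codiscrete ℂ, _ := ((tendsto_add_const_codiscrete t₀).eventually h).and hreg
    open Polynomial in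
    set P : ℂ[X] := C (c ^ 2 * (2 * q.δ₁ + q.δ₂ + q.δ₄ * c ^ 2)) * X ^ 4
      + C (c * (-2 * (q.δ₁ * h₀ + q.δ₅) - 4 * q.δ₄ * h₀ * c ^ 2 - q.δ₈ * c ^ 2)) * X ^ 3
      + C (c ^ 2 * (-6 * A * (q.δ₁ + q.δ₂) + 6 * q.δ₄ * h₀ ^ 2 + 3 * q.δ₈ * h₀ + q.δ₉)) * X ^ 2
      + C (c * (6 * A * (q.δ₁ * h₀ + q.δ₅) - 2 * B * c * (q.δ₁ + 2 * q.δ₂) - 4 * q.δ₄ * h₀ ^ 3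
        - 3 * q.δ₈ * h₀ ^ 2 - 2 * q.δ₉ * h₀ - q.δ₁₀)) * X
      + C (2 * B * c * (q.δ₁ * h₀ + q.δ₅) + q.δ₂ * c ^ 2 * (L.g₂ - 3 * A ^ 2) + q.δ₄ * h₀ ^ 4
        + q.δ₈ * h₀ ^ 3 + q.δ₉ * h₀ ^ 2 + q.δ₁₀ * h₀ + q.δ₁₁) with hP
    open Polynomial in
    set Q : ℂ[X] := C (c * (-6 - q.δ₃ * c ^ 2)) * X ^ 2
        + C (c ^ 2 * (2 * q.δ₃ * h₀ + q.δ₆)) * X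
        + C (c * (6 * A - q.δ₃ * h₀ ^ 2 - q.δ₆ * h₀ - q.δ₇)) with hQ
    -- Multiplying `P(φ) + Q(φ) φ' = 0` by its conjugate `P(φ) - Q(φ) φ'` eliminates `φ'`. As `φ`
    -- has a pole, it satisfies no nontrivial algebraic equation.
    open Polynomial in
    have hPQ : P ^ 2 - Q ^ 2 * (X ^ 4 + C (-6 * A) * X ^ 2 + C (-4 * B) * X
        + C (L.g₂ - 3 * A ^ 2)) = 0 := by
      refine eq_zero_of_eventually_eval_eq_zero hφ.meromorphic (z := 0)
        (by rw [L.order_addQuotient_of_mem A B (zero_mem _)]; decide) ?_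
      filter_upwards [h1] with s hs
      obtain ⟨h2, h3, h4⟩ := hs
      rw [lhs_addQuotient hB q hq c h₀ t₀ (by simpa using h3) (by simpa using h4),
        add_sub_cancel_right] at h2
      have h5 := addQuotient_deriv_sq hB h3 h4
      have hPe : P.eval (L.addQuotient A B s) + Q.eval (L.addQuotient A B s) *
          (2 * L.weierstrassP s + A - L.addQuotient A B s ^ 2) = 0 := by
        rw [← h2, hP, hQ]
        simp only [eval_add, eval_mul, eval_C, eval_X, eval_pow]
      have hR : (X ^ 4 + C (-6 * A) * X ^ 2 + C (-4 * B) * X + C (L.g₂ - 3 * A ^ 2)).eval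
          (L.addQuotient A B s) =
          (2 * L.weierstrassP s + A - L.addQuotient A B s ^ 2) ^ 2 := by
        simp only [eval_add, eval_mul, eval_C, eval_X, eval_pow]
        rw [h5]; ring
      rw [eval_sub, eval_mul, eval_pow, eval_pow, hR]
      linear_combination (P.eval (L.addQuotient A B s) - Q.eval (L.addQuotient A B s) *
          (2 * L.weierstrassP s + A - L.addQuotient A B s ^ 2)) * hPe
    obtain ⟨hP0, hQ0⟩ := eq_zero_of_sq_eq_sq_mul_quartic (sub_eq_zero.1 hPQ) (quartic_not_square hB)
    rw [hP] at hP0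
    rw [hQ] at hQ0
    have e1 := quartic_coeffs_eq_zero hP0
    have e2 := quadratic_coeffs_eq_zero hQ0
    simp only [mul_eq_zero, hc, false_or, pow_eq_zero_iff, ne_eq, OfNat.ofNat_ne_zero,
      not_false_eq_true] at e1 e2
    exact ⟨by simpa [hc] using e2, by simpa [hc] using e1⟩
  · rintro ⟨⟨e1, e2, e3⟩, e4, e5, e6, e7, e8⟩
    filter_upwards [(tendsto_sub_const_codiscrete t₀).eventually hreg] with t ht
    rw [lhs_addQuotient hB q hq c h₀ t₀ ht.1 ht.2, e1, e2, e3, e4, e5, e6, e7, e8]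
    ring

/-- Again of the shape `P(℘) + Q(℘) ℘'`, using `℘'' = 6℘² - g₂/2`, `℘''' = 12 ℘ ℘'` and the cubic
relation for `℘'²`. -/
lemma lhs_weierstrassP (q : DHCoeffs) (hq : q.γ₁ = 1) (c h₀ t₀ : ℂ) {t : ℂ}
    (ht : t - t₀ ∉ L.lattice) :
    q.lhs (fun t ↦ c * L.weierstrassP (t - t₀) + h₀) t =
      (c ^ 4 * q.δ₄) * L.weierstrassP (t - t₀) ^ 4
      + (c ^ 2 * (6 * q.δ₁ + 4 * q.δ₂ + 4 * q.δ₄ * c * h₀ + q.δ₈ * c)) *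
        L.weierstrassP (t - t₀) ^ 3
      + (c * (6 * (q.δ₁ * h₀ + q.δ₅) + 6 * q.δ₄ * c * h₀ ^ 2 + 3 * q.δ₈ * c * h₀ + q.δ₉ * c)) *
        L.weierstrassP (t - t₀) ^ 2
      + (c * (-c * q.δ₁ * L.g₂ / 2 - q.δ₂ * c * L.g₂ + 4 * q.δ₄ * h₀ ^ 3 + 3 * q.δ₈ * h₀ ^ 2
        + 2 * q.δ₉ * h₀ + q.δ₁₀)) * L.weierstrassP (t - t₀)
      + (-(q.δ₁ * h₀ + q.δ₅) * c * L.g₂ / 2 - q.δ₂ * c ^ 2 * L.g₃ + q.δ₄ * h₀ ^ 4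
        + q.δ₈ * h₀ ^ 3 + q.δ₉ * h₀ ^ 2 + q.δ₁₀ * h₀ + q.δ₁₁)
      + ((c ^ 3 * q.δ₃) * L.weierstrassP (t - t₀) ^ 2
        + (c * (12 + 2 * q.δ₃ * c * h₀ + q.δ₆ * c)) * L.weierstrassP (t - t₀)
        + c * (q.δ₃ * h₀ ^ 2 + q.δ₆ * h₀ + q.δ₇)) * L.derivWeierstrassP (t - t₀) := by
  rw [q.lhs_affine (f := L.weierstrassP) (f₁ := L.derivWeierstrassP)
    (f₂ := fun z ↦ 6 * L.weierstrassP z ^ 2 - L.g₂ / 2)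
    (f₃ := fun z ↦ 12 * L.weierstrassP z * L.derivWeierstrassP z)]
  · have h1 := L.derivWeierstrassP_sq _ ht
    rw [hq]
    linear_combination q.δ₂ * c ^ 2 * h1
  · filter_upwards [L.eventually_nhds_notMem_lattice ht] with s hs
    have h1 := L.hasDerivAt_weierstrassP hs
    refine ⟨h1, L.hasDerivAt_derivWeierstrassP hs, ?_⟩
    refine (((h1.fun_pow 2).const_mul 6).sub_const _).congr_deriv ?_
    norm_num
    ring

/-- The differential equation for an affine image of `℘`. -/
theorem isSolution_weierstrassP_iff (q : DHCoeffs) (hq : q.γ₁ = 1) {c : ℂ} (hc : c ≠ 0)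
    (h₀ t₀ : ℂ) {w : ℂ → ℂ} (hw : w =ᶠ[codiscrete ℂ] fun t ↦ c * L.weierstrassP (t - t₀) + h₀) :
    q.IsSolution w ↔ q.DoublePoleEquations c h₀ L.g₂ L.g₃ := by
  have hel := L.isElliptic_weierstrassP
  have hmer : Meromorphic w :=
    (((hel.comp_sub_const t₀).const_mul c).add (.const h₀)).meromorphic.congr_codiscrete hw.symm
  rw [q.isSolution_iff hmer hw]
  constructor
  · intro h
    have h1 := ((tendsto_add_const_codiscrete t₀).eventually h)
    have h1' := tendsto_neg_codiscrete.eventually h1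
    open Polynomial in
    set P : ℂ[X] := C (c ^ 4 * q.δ₄) * X ^ 4
      + C (c ^ 2 * (6 * q.δ₁ + 4 * q.δ₂ + 4 * q.δ₄ * c * h₀ + q.δ₈ * c)) * X ^ 3
      + C (c * (6 * (q.δ₁ * h₀ + q.δ₅) + 6 * q.δ₄ * c * h₀ ^ 2 + 3 * q.δ₈ * c * h₀
        + q.δ₉ * c)) * X ^ 2
      + C (c * (-c * q.δ₁ * L.g₂ / 2 - q.δ₂ * c * L.g₂ + 4 * q.δ₄ * h₀ ^ 3 + 3 * q.δ₈ * h₀ ^ 2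
        + 2 * q.δ₉ * h₀ + q.δ₁₀)) * X
      + C (-(q.δ₁ * h₀ + q.δ₅) * c * L.g₂ / 2 - q.δ₂ * c ^ 2 * L.g₃ + q.δ₄ * h₀ ^ 4
        + q.δ₈ * h₀ ^ 3 + q.δ₉ * h₀ ^ 2 + q.δ₁₀ * h₀ + q.δ₁₁) with hP
    open Polynomial in
    set Q : ℂ[X] := C (c ^ 3 * q.δ₃) * X ^ 2
        + C (c * (12 + 2 * q.δ₃ * c * h₀ + q.δ₆ * c)) * X
        + C (c * (q.δ₃ * h₀ ^ 2 + q.δ₆ * h₀ + q.δ₇)) with hQ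
    have hPQ : ∀ s ∉ L.lattice, q.lhs (fun t ↦ c * L.weierstrassP (t - t₀) + h₀) (s + t₀) =
        P.eval (L.weierstrassP s) + Q.eval (L.weierstrassP s) * L.derivWeierstrassP s := by
      intro s hs
      rw [lhs_weierstrassP q hq c h₀ t₀ (by simpa using hs), add_sub_cancel_right, hP, hQ]
      simp only [Polynomial.eval_add, Polynomial.eval_mul, Polynomial.eval_C, Polynomial.eval_X,
        Polynomial.eval_pow]
    -- Since `℘` is even and `℘'` odd, the equations at `s` and `-s` separate `P` from `Q`.
    have h2 : ∀ᶠ s in codiscrete ℂ, P.eval (L.weierstrassP s) = 0 ∧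
        Q.eval (L.weierstrassP s) = 0 := by
      filter_upwards [h1, h1', L.eventually_notMem_lattice, L.eventually_derivWeierstrassP_ne 0]
        with s e1 e2 e3 e4
      rw [hPQ s e3] at e1
      rw [hPQ (-s) (by rwa [L.neg_mem_lattice_iff])] at e2
      simp only [weierstrassP_neg, derivWeierstrassP_neg] at e2
      have e5 : P.eval (L.weierstrassP s) = 0 := by linear_combination e1 / 2 + e2 / 2
      refine ⟨e5, ?_⟩
      rw [e5, zero_add] at e1
      exact (mul_eq_zero.1 e1).resolve_right e4
    have hneg := L.order_weierstrassP_neg_iff.2 (zero_mem L.lattice)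
    have hP0 := Polynomial.eq_zero_of_eventually_eval_eq_zero hel.meromorphic hneg
      (h2.mono fun _ h ↦ h.1)
    have hQ0 := Polynomial.eq_zero_of_eventually_eval_eq_zero hel.meromorphic hneg
      (h2.mono fun _ h ↦ h.2)
    rw [hP] at hP0
    rw [hQ] at hQ0
    have e1 := quartic_coeffs_eq_zero hP0
    have e2 := quadratic_coeffs_eq_zero hQ0
    simp only [mul_eq_zero, hc, false_or, pow_eq_zero_iff, ne_eq, OfNat.ofNat_ne_zero,
      not_false_eq_true] at e1 e2
    exact ⟨e2, e1⟩
  · rintro ⟨⟨e1, e2, e3⟩, e4, e5, e6, e7, e8⟩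
    filter_upwards [(tendsto_sub_const_codiscrete t₀).eventually L.eventually_notMem_lattice]
      with t ht
    rw [lhs_weierstrassP q hq c h₀ t₀ ht, e2, e3, e5, e6, e7, e8, e1, e4]
    ring

end PeriodPair

/-! ### Solving the coefficient equations -/

namespace DHCoeffs

/-- The two coefficient equations that remain once the common conditions hold. -/
lemma simplePoleFamilies_iff {s c h A b e f d₂ d₁₀ d₁₁ g₂ : ℂ} (hs : s ≠ 0) (hcs : s * c ^ 2 = -6)
    {q : DHCoeffs} (h2 : q.δ₂ = d₂) (h3 : q.δ₃ = s) (h4 : q.δ₄ = e * s) (h6 : q.δ₆ = -2 * s * h)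
    (h7 : q.δ₇ = 6 * A + s * h ^ 2) (h8 : q.δ₈ = f * s) (h10 : q.δ₁₀ = d₁₀) (h11 : q.δ₁₁ = d₁₁) :
    (d₁₀ = 18 * b * (2 * e + d₂) + 18 * A * f + 36 * A * e * h - 6 * A * d₂ * h
        + 3 * f * s * h ^ 2 + 8 * e * s * h ^ 3 ∧
      s * d₁₁ = s * (36 * b * (f + 4 * e * h) - d₁₀ * h + 2 * f * s * h ^ 3 + 5 * e * s * h ^ 4
        - 18 * A * e * h ^ 2 - 3 * A * d₂ * h ^ 2) + 6 * d₂ * (g₂ - 3 * A ^ 2)) ↔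
    (SimplePoleFamily₁ q ∨ SimplePoleFamily₂ q c (c * s * b) ∨ SimplePoleFamily₃ q c (c * s * b) ∨
      SimplePoleFamily₄ q c (c * s * b) g₂ ∨ SimplePoleFamily₅ q c (c * s * b) g₂) := by
  have hc : c ≠ 0 := by rintro rfl; norm_num at hcs
  have hcinv : c ^ 2 = -6 / s := by field_simp; linear_combination hcs
  simp only [SimplePoleFamily₁, SimplePoleFamily₂, SimplePoleFamily₃, SimplePoleFamily₄,
    SimplePoleFamily₅, μ₁, μ₂, h2, h3, h4, h6, h7, h8, h10, h11]
  -- With `B = c s b`, the constant `c` enters the fourth family's `g₂` only through `c² = -6 / s`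
  -- and can be eliminated.
  have hG (hd : d₂ ≠ 0) (N : ℂ) : c * ((-2 * s * h + f * s / d₂) * (c * s * b)
      + c * (N / (144 * d₂ * s))) =
        (-144 * (f - 2 * h * d₂) * s ^ 3 * b - N) / (24 * d₂ * s ^ 2) := by
    rw [show c * ((-2 * s * h + f * s / d₂) * (c * s * b) + c * (N / (144 * d₂ * s))) =
      c ^ 2 * ((-2 * s * h + f * s / d₂) * (s * b) + N / (144 * d₂ * s)) by ring, hcinv]
    field_simp
    ring
  constructor
  · rintro ⟨E7, E8⟩
    have hB {N D : ℂ} (hD : D ≠ 0) (h : s * b * D = N) : c * s * b = c * (N / D) := by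
      rw [mul_assoc, eq_div_of_mul_eq hD h]
    -- The first equation contains `b` with coefficient `18 (2e + d₂)`, the second contains `g₂`
    -- with coefficient `6 d₂`. For `d₂ = 0` the unknown `g₂` drops out and `b` is fixed by the
    -- first equation if `e ≠ 0`, by the second if `e = 0 ≠ f`, and not at all if `e = f = 0`. For
    -- `d₂ ≠ 0` the second equation fixes `g₂`, and the first fixes `b` unless `2e + d₂ = 0`.
    by_cases hd : d₂ = 0
    · subst hd
      by_cases he : e = 0
      · subst he
        by_cases hf : f = 0
        · subst hf
          have h10' : d₁₀ = 0 := by linear_combination E7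
          exact .inl ⟨rfl, by ring, by ring, h10', mul_left_cancel₀ hs (by rw [E8, h10']; ring)⟩
        · refine .inr (.inl ⟨rfl, by ring, mul_ne_zero hf hs, ?_, hB ?_ ?_⟩)
          · rw [eq_div_iff hs]
            linear_combination s * E7
          · simp [hf, hs]
          · linear_combination -4 * s ^ 2 * E8
      · refine .inr (.inr (.inl ⟨rfl, mul_ne_zero he hs, ?_, hB ?_ ?_⟩))
        · rw [eq_div_iff (by simp [he, hs])]
          linear_combination 4 * s ^ 3 * e * E8 - 4 * s ^ 4 * (f + 4 * e * h) * E7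
        · simp [he, hs]
        · linear_combination -4 * s ^ 3 * E7
    · by_cases hu : 2 * e + d₂ = 0
      · obtain rfl : e = -d₂ / 2 := by linear_combination hu / 2
        refine .inr (.inr (.inr (.inl ⟨hd, by ring, ?_, ?_⟩)))
        · rw [eq_div_iff hs]
          linear_combination s * E7
        · rw [hG hd, eq_div_iff (by simp [hs, hd])]
          linear_combination -4 * s ^ 2 * E8 + 4 * s ^ 3 * h * E7
      · have hu' : d₂ * s + 2 * (e * s) ≠ 0 := by
          rw [show d₂ * s + 2 * (e * s) = (2 * e + d₂) * s by ring]
          exact mul_ne_zero hu hs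
        refine .inr (.inr (.inr (.inr ⟨hd, fun h ↦ hu' (by rw [h]; ring), hB ?_ ?_, ?_⟩)))
        · simp [hu', hs]
        · linear_combination -8 * s ^ 3 * E7
        · rw [eq_div_iff (by simp [hu', hs, hd])]
          linear_combination -8 * s ^ 3 * (2 * e + d₂) * E8 + 16 * s ^ 4 * (f + 4 * e * h) * E7
  · have hB {N D : ℂ} (hD : D ≠ 0) (h : c * s * b = c * (N / D)) : s * b * D = N := by
      rw [mul_assoc] at h
      exact (eq_div_iff hD).1 (mul_left_cancel₀ hc h)
    rintro (⟨rfl, e2, e3, rfl, rfl⟩ | ⟨rfl, e2, e3, e4, e5⟩ | ⟨rfl, e2, e3, e4⟩ | ⟨hd, e2, e3, e4⟩ |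
      ⟨hd, e2, e3, e4⟩)
    · obtain rfl : e = 0 := by simpa [hs] using e2
      obtain rfl : f = 0 := by simpa [hs] using e3
      constructor <;> ring
    · obtain rfl : e = 0 := by simpa [hs] using e2
      rw [eq_div_iff hs] at e4
      replace e5 := hB (by simpa [hs] using e3) e5
      exact ⟨mul_left_cancel₀ hs (by linear_combination e4),
        mul_left_cancel₀ (a := 4 * s ^ 2) (by simp [hs]) (by linear_combination -e5)⟩
    · have he : e ≠ 0 := by rintro rfl; simp at e2
      rw [eq_div_iff (by simp [hs, he])] at e3
      replace e4 := hB (by simp [hs, he]) e4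
      have E7 : d₁₀ = 18 * b * (2 * e + 0) + 18 * A * f + 36 * A * e * h - 6 * A * 0 * h
          + 3 * f * s * h ^ 2 + 8 * e * s * h ^ 3 :=
        mul_left_cancel₀ (a := 4 * s ^ 3) (by simp [hs]) (by linear_combination -e4)
      refine ⟨E7, mul_left_cancel₀ (a := 4 * s ^ 3 * e) (by simp [hs, he]) ?_⟩
      linear_combination e3 + 4 * s ^ 4 * (f + 4 * e * h) * E7
    · obtain rfl : e = -d₂ / 2 := mul_left_cancel₀ hs (by linear_combination e2)
      rw [eq_div_iff hs] at e3
      rw [hG hd, eq_div_iff (by simp [hs, hd])] at e4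
      have E7 : d₁₀ = 18 * b * (2 * (-d₂ / 2) + d₂) + 18 * A * f + 36 * A * (-d₂ / 2) * h
          - 6 * A * d₂ * h + 3 * f * s * h ^ 2 + 8 * (-d₂ / 2) * s * h ^ 3 :=
        mul_left_cancel₀ hs (by linear_combination e3)
      refine ⟨E7, mul_left_cancel₀ (a := 4 * s ^ 2) (by simp [hs]) ?_⟩
      linear_combination -e4 + 4 * s ^ 3 * h * E7
    · have hu : d₂ * s + 2 * (e * s) ≠ 0 := fun h ↦ e2 (by linear_combination h / 2)
      have hu' : 2 * e + d₂ ≠ 0 := fun h ↦ hu (by linear_combination s * h)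
      replace e3 := hB (by simp [hs, hu]) e3
      rw [eq_div_iff (by simp [hs, hu, hd])] at e4
      have E7 : d₁₀ = 18 * b * (2 * e + d₂) + 18 * A * f + 36 * A * e * h - 6 * A * d₂ * h
          + 3 * f * s * h ^ 2 + 8 * e * s * h ^ 3 :=
        mul_left_cancel₀ (a := 8 * s ^ 3) (by simp [hs]) (by linear_combination -e3)
      refine ⟨E7, mul_left_cancel₀ (a := 8 * s ^ 3 * (2 * e + d₂)) (by simp [hs, hu']) ?_⟩
      linear_combination -e4 + 16 * s ^ 4 * (f + 4 * e * h) * E7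

/-- The common conditions solved for the coefficients of the equation. -/
lemma simplePoleCommon_iff {q : DHCoeffs} {c h₀ A B g₂ g₃ : ℂ} :
    SimplePoleCommon q c h₀ A B g₂ g₃ ↔ B ^ 2 = 4 * A ^ 3 - g₂ * A - g₃ ∧ ∃ e f : ℂ,
      q.δ₃ ≠ 0 ∧ q.δ₃ * c ^ 2 = -6 ∧ q.δ₄ = e * q.δ₃ ∧ q.δ₈ = f * q.δ₃ ∧
      q.δ₆ = -2 * q.δ₃ * h₀ ∧ q.δ₇ = 6 * A + q.δ₃ * h₀ ^ 2 ∧ q.δ₁ = 3 * e - q.δ₂ / 2 ∧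
      q.δ₅ = 3 * f + 9 * e * h₀ + q.δ₂ * h₀ / 2 ∧
      q.δ₉ = 3 * A * (6 * e + q.δ₂) - 6 * e * q.δ₃ * h₀ ^ 2 - 3 * f * q.δ₃ * h₀ := by
  constructor
  · rintro ⟨hs, e1, e2, e3, e4, e5, e6, e7⟩
    have h6 : q.δ₆ = -2 * q.δ₃ * h₀ := by rw [e2]; field_simp
    have h7 : q.δ₇ = 6 * A + q.δ₃ * h₀ ^ 2 := by rw [e3, h6]; field_simp; ring
    refine ⟨by rw [e4]; ring, q.δ₄ / q.δ₃, q.δ₈ / q.δ₃, hs, by rw [e1]; field_simp, by field_simp,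
      by field_simp, h6, h7, ?_, ?_, ?_⟩
    · rw [e5]; ring
    · rw [e6, h6]; field_simp; ring
    · rw [e7, h7, h6]; field_simp; ring
  · rintro ⟨hB, e, f, hs, hc, h4, h8, h6, h7, h1, h5, h9⟩
    refine ⟨hs, ?_, ?_, ?_, by linear_combination hB, ?_, ?_, ?_⟩
    · field_simp; linear_combination hc
    · rw [h6]; field_simp
    · rw [h7, h6]; field_simp; ring
    · rw [h1, h4]; field_simp
    · rw [h5, h4, h6, h8]; field_simp; ring
    · rw [h9, h4, h6, h7, h8]; field_simp; ring

/-- The system is triangular: its first six equations fix `c²` and express `δ₆`, `δ₇`, `δ₁`, `δ₅`,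
`δ₉` in turn, which are the common conditions. The last two produce the families. -/
theorem simplePoleEquations_iff {q : DHCoeffs} {c h₀ A B g₂ g₃ : ℂ}
    (hB : B ^ 2 = 4 * A ^ 3 - g₂ * A - g₃) :
    q.SimplePoleEquations c h₀ A B g₂ ↔ SimplePoleParams q c h₀ A B g₂ g₃ := by
  rw [SimplePoleParams, simplePoleCommon_iff]
  constructor
  · rintro ⟨⟨e1, e2, e3⟩, e4, e5, e6, e7, e8⟩
    have hcs : q.δ₃ * c ^ 2 = -6 := by linear_combination -e1
    have hs : q.δ₃ ≠ 0 := by intro h; norm_num [h] at hcs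
    have hc : c ≠ 0 := by rintro rfl; norm_num at hcs
    have h6 : q.δ₆ = -2 * q.δ₃ * h₀ := by linear_combination e2
    have h7 : q.δ₇ = 6 * A + q.δ₃ * h₀ ^ 2 := by linear_combination -e3 - h₀ * h6
    obtain ⟨e, h4⟩ : ∃ e, q.δ₄ = e * q.δ₃ := ⟨_, (div_mul_cancel₀ _ hs).symm⟩
    obtain ⟨f, h8⟩ : ∃ f, q.δ₈ = f * q.δ₃ := ⟨_, (div_mul_cancel₀ _ hs).symm⟩
    -- In this parametrisation `B c = -6 b`, so the remaining equations no longer involve the sign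
    -- of `c`.
    obtain ⟨b, rfl⟩ : ∃ b, B = c * q.δ₃ * b := ⟨B / (c * q.δ₃), by field_simp⟩
    have h1 : q.δ₁ = 3 * e - q.δ₂ / 2 := by
      linear_combination e4 / 2 - c ^ 2 / 2 * h4 - e / 2 * hcs
    have h5 : q.δ₅ = 3 * f + 9 * e * h₀ + q.δ₂ * h₀ / 2 := by
      linear_combination -e5 / 2 - h₀ * h1 - 2 * h₀ * c ^ 2 * h4 - c ^ 2 / 2 * h8
        - (f / 2 + 2 * h₀ * e) * hcs
    have h9 : q.δ₉ = 3 * A * (6 * e + q.δ₂) - 6 * e * q.δ₃ * h₀ ^ 2 - 3 * f * q.δ₃ * h₀ := by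
      linear_combination e6 + 6 * A * h1 - 6 * h₀ ^ 2 * h4 - 3 * h₀ * h8
    refine ⟨⟨hB, e, f, hs, hcs, h4, h8, h6, h7, h1, h5, h9⟩,
      (simplePoleFamilies_iff hs hcs rfl rfl h4 h6 h7 h8 rfl rfl).1 ⟨?_, ?_⟩⟩
    · rw [h1, h4, h5, h8, h9] at e7
      linear_combination -e7 - 6 * b * (e + q.δ₂ / 2) * hcs
    · rw [h1, h4, h5, h8, h9] at e8
      linear_combination q.δ₃ * e8
        - (6 * b * q.δ₃ * (f + 4 * e * h₀) + q.δ₂ * (g₂ - 3 * A ^ 2)) * hcs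
  · rintro ⟨⟨hB, e, f, hs, hcs, h4, h8, h6, h7, h1, h5, h9⟩, hF⟩
    have hc : c ≠ 0 := by rintro rfl; norm_num at hcs
    obtain ⟨b, rfl⟩ : ∃ b, B = c * q.δ₃ * b := ⟨B / (c * q.δ₃), by field_simp⟩
    obtain ⟨E7, E8⟩ := (simplePoleFamilies_iff hs hcs rfl rfl h4 h6 h7 h8 rfl rfl).2 hF
    refine ⟨⟨by linear_combination -hcs, by linear_combination h6, ?_⟩, ?_, ?_, ?_, ?_, ?_⟩
    · linear_combination -h7 - h₀ * h6
    · linear_combination 2 * h1 + c ^ 2 * h4 + e * hcs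
    · linear_combination -2 * h5 - 2 * h₀ * h1 - 4 * h₀ * c ^ 2 * h4 - c ^ 2 * h8
        - (f + 4 * h₀ * e) * hcs
    · linear_combination h9 - 6 * A * h1 + 6 * h₀ ^ 2 * h4 + 3 * h₀ * h8
    · rw [h1, h4, h5, h8, h9]
      linear_combination -E7 - 6 * b * (2 * e + q.δ₂ / 2 * 2) / 2 * hcs
    · refine mul_left_cancel₀ hs ?_
      rw [h1, h4, h5, h8, h9]
      linear_combination E8
        + (6 * b * q.δ₃ * (f + 4 * e * h₀) + q.δ₂ * (g₂ - 3 * A ^ 2)) * hcs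

/-- The two coefficient equations that remain once the common conditions hold. -/
lemma doublePoleFamilies_iff {s h d₁ d₂ d₅ d₁₀ d₁₁ g₂ g₃ : ℂ} (hs : s ≠ 0)
    {q : DHCoeffs} (h1 : q.δ₁ = d₁) (h2 : q.δ₂ = d₂) (h5 : q.δ₅ = d₅) (h6 : q.δ₆ = s)
    (h7 : q.δ₇ = -s * h) (h10 : q.δ₁₀ = d₁₀) (h11 : q.δ₁₁ = d₁₁) :
    (6 * (d₁ + 2 * d₂) * g₂ + s * (d₅ * s * h - s * h ^ 2 * (d₁ + 2 * d₂) / 2 + d₁₀) = 0 ∧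
      6 * s * (d₁ * h + d₅) * g₂ - 144 * d₂ * g₃ + s ^ 2 * (s * h ^ 3 * (d₂ / 3 + d₁ / 2)
        + d₅ * s * h ^ 2 / 2 - (d₁ + d₂) * s * h ^ 3 + d₁₀ * h + d₁₁) = 0) ↔
    (DoublePoleFamily₁ q g₂ g₃ ∨ DoublePoleFamily₂ q g₂ ∨ DoublePoleFamily₃ q g₂ g₃ ∨
      DoublePoleFamily₄ q g₂ ∨ DoublePoleFamily₅ q) := by
  simp only [DoublePoleFamily₁, DoublePoleFamily₂, DoublePoleFamily₃, DoublePoleFamily₄,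
    DoublePoleFamily₅, h1, h2, h5, h6, h7, h10, h11]
  have hG {u : ℂ} (hu : u ≠ 0) : (-s * h) ^ 2 / 12 + (d₅ * (-s * h) - d₁₀) * s / (6 * u) =
      (s ^ 2 * h ^ 2 * u / 2 - (d₅ * s * h + d₁₀) * s) / (6 * u) := by
    field_simp
    ring
  have hG3 {u : ℂ} (hd : d₂ ≠ 0) (hu : u ≠ 0) : (-s * h) ^ 3 / 216 + s ^ 2 * d₁₁ / (144 * d₂)
      + (d₅ * s + 2 * d₂ * (-s * h)) * (d₅ * (-s * h) - d₁₀) * s / (144 * u * d₂) =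
      ((-s * h) ^ 3 * 2 / 3 * u * d₂ + s ^ 2 * d₁₁ * u
      - (d₅ * s - 2 * d₂ * s * h) * (d₅ * s * h + d₁₀) * s) / (144 * u * d₂) := by
    field_simp
    ring
  have hG3' (hd : d₂ ≠ 0) : (-s * h + d₅ * s / (2 * d₂)) * g₂ / 12 - (-s * h) ^ 3 / 432
      + (2 * s * d₁₁ - d₅ * (-s * h) ^ 2) * s / (288 * d₂) =
      ((-2 * d₂ * s * h + d₅ * s) * g₂ * 12 - (-s * h) ^ 3 * 2 * d₂ / 3
      + (2 * s * d₁₁ - d₅ * s ^ 2 * h ^ 2) * s) / (288 * d₂) := by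
    field_simp
    ring
  have hG' (h5 : d₅ ≠ 0) : (-s * h) ^ 2 / 12 - s * d₁₁ / (6 * d₅) =
      (s ^ 2 * h ^ 2 * d₅ - 2 * s * d₁₁) / (12 * d₅) := by
    field_simp
    ring
  constructor
  · rintro ⟨E7, E8⟩
    -- The coefficient of `g₂` in the first equation is `6 (d₁ + 2d₂)` and that of `g₃` in the
    -- second is `-144 d₂`. If both vanish, then `d₁ = d₂ = 0`, and the second equation still fixes
    -- `g₂` unless `d₅ = 0`.
    by_cases hu : d₁ + 2 * d₂ = 0
    · obtain rfl : d₁ = -2 * d₂ := by linear_combination hu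
      have h10' : d₁₀ = d₅ * (-s * h) := mul_left_cancel₀ hs (by linear_combination E7)
      by_cases hd : d₂ = 0
      · by_cases h5 : d₅ = 0
        · refine .inr (.inr (.inr (.inr ⟨by simp [hd], hd, h5, by simp [h10', h5], ?_⟩)))
          rw [h10', h5, hd] at E8
          exact mul_left_cancel₀ (pow_ne_zero 2 hs) (by linear_combination E8)
        · refine .inr (.inr (.inr (.inl ⟨by simp [hd], hd, h10', h5, ?_⟩)))
          rw [h10', hd] at E8
          rw [hG' h5, eq_div_iff (by simp [h5])]
          exact mul_left_cancel₀ hs (by linear_combination 2 * E8)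
      · refine .inr (.inr (.inl ⟨rfl, hd, h10', ?_⟩))
        rw [h10'] at E8
        rw [hG3' hd, eq_div_iff (by simp [hd])]
        linear_combination -2 * E8
    · by_cases hd : d₂ = 0
      · have h1 : d₁ ≠ 0 := by simpa [hd] using hu
        refine .inr (.inl ⟨hd, h1, ?_, ?_⟩)
        · rw [eq_div_iff h1]
          rw [hd] at E7 E8
          exact mul_left_cancel₀ (pow_ne_zero 2 hs)
            (by linear_combination d₁ * E8 - s * (d₁ * h + d₅) * E7)
        · rw [hd] at E7
          rw [hG h1, eq_div_iff (by simp [h1])]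
          linear_combination E7
      · refine .inl ⟨hd, fun h ↦ hu (by rw [h]; ring), ?_, ?_⟩
        · rw [hG hu, eq_div_iff (by simp [hu])]
          linear_combination E7
        · rw [hG3 hd hu, eq_div_iff (by simp [hu, hd])]
          linear_combination -(d₁ + 2 * d₂) * E8 + s * (d₁ * h + d₅) * E7
  · rintro (⟨hd, hu, e1, e2⟩ | ⟨rfl, hu, e1, e2⟩ | ⟨rfl, hd, rfl, e1⟩ | ⟨rfl, rfl, rfl, h5, e1⟩ |
      ⟨rfl, rfl, rfl, rfl, rfl⟩)
    · replace hu : d₁ + 2 * d₂ ≠ 0 := fun h ↦ hu (by linear_combination h)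
      rw [hG hu, eq_div_iff (by simp [hu])] at e1
      rw [hG3 hd hu, eq_div_iff (by simp [hu, hd])] at e2
      refine ⟨by linear_combination e1, mul_left_cancel₀ hu ?_⟩
      linear_combination -e2 + s * (d₁ * h + d₅) * e1
    · rw [hG hu, eq_div_iff (by simp [hu])] at e2
      rw [eq_div_iff hu] at e1
      refine ⟨by linear_combination e2, mul_left_cancel₀ hu ?_⟩
      linear_combination s ^ 2 * e1 + s * (d₁ * h + d₅) * e2
    · rw [hG3' hd, eq_div_iff (by simp [hd])] at e1
      exact ⟨by ring, by linear_combination -e1 / 2⟩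
    · rw [hG' h5, eq_div_iff (by simp [h5])] at e1
      exact ⟨by ring, by linear_combination s * e1 / 2⟩
    · constructor <;> ring

/-- The coefficient equations of the second kind describe the families with a double pole. -/
theorem doublePoleEquations_iff {q : DHCoeffs} {c h₀ g₂ g₃ : ℂ} (hc : c ≠ 0) :
    q.DoublePoleEquations c h₀ g₂ g₃ ↔ DoublePoleParams q c h₀ g₂ g₃ := by
  rw [DoublePoleParams, DoublePoleCommon]
  constructor
  · rintro ⟨⟨h3, e2, e3⟩, h4, e5, e6, e7, e8⟩
    rw [h3] at e2 e3
    rw [h4] at e5 e6 e7 e8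
    have hcs : q.δ₆ * c = -12 := by linear_combination e2
    have hs : q.δ₆ ≠ 0 := by intro h; norm_num [h] at hcs
    have h7 : q.δ₇ = -q.δ₆ * h₀ := by linear_combination e3
    have h8 : q.δ₈ = q.δ₆ / 6 * (2 * q.δ₂ + 3 * q.δ₁) := mul_right_cancel₀ hc
      (by linear_combination e5 - (2 * q.δ₂ + 3 * q.δ₁) / 6 * hcs)
    have h9 : q.δ₉ = q.δ₅ * q.δ₆ / 2 + (q.δ₁ + q.δ₂) * q.δ₇ := mul_right_cancel₀ hc
      (by
        rw [h8] at e6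
        linear_combination e6 - (q.δ₅ / 2 + h₀ / 2 * (2 * q.δ₂ + 3 * q.δ₁)
          - (q.δ₁ + q.δ₂) * h₀) * hcs - (q.δ₁ + q.δ₂) * c * h7)
    refine ⟨⟨h3, h4, hs, by rw [eq_div_iff hs]; linear_combination hcs,
      by rw [h7]; field_simp, h8, h9⟩, (doublePoleFamilies_iff hs rfl rfl rfl rfl h7 rfl rfl).1
        ⟨?_, ?_⟩⟩
    · rw [h9, h8, h7] at e7
      linear_combination q.δ₆ * e7 + (q.δ₁ / 2 + q.δ₂) * g₂ * hcs
    · rw [h9, h8, h7] at e8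
      linear_combination q.δ₆ ^ 2 * e8 + (q.δ₁ * h₀ + q.δ₅) * g₂ / 2 * q.δ₆ * hcs
        + q.δ₂ * g₃ * (q.δ₆ * c - 12) * hcs
  · rintro ⟨⟨h3, h4, hs, e1, e2, h8, h9⟩, hF⟩
    have hcs : q.δ₆ * c = -12 := by rw [e1]; field_simp
    have h7 : q.δ₇ = -q.δ₆ * h₀ := by rw [e2]; field_simp
    obtain ⟨E7, E8⟩ := (doublePoleFamilies_iff hs rfl rfl rfl rfl h7 rfl rfl).2 hF
    refine ⟨⟨h3, ?_, ?_⟩, h4, ?_, ?_, mul_left_cancel₀ hs ?_,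
      mul_left_cancel₀ (pow_ne_zero 2 hs) ?_⟩
    · rw [h3]; linear_combination hcs
    · rw [h3]; linear_combination h7
    · rw [h4, h8]; linear_combination (2 * q.δ₂ + 3 * q.δ₁) / 6 * hcs
    · rw [h4, h9, h8, h7]
      linear_combination (q.δ₅ / 2 + h₀ / 2 * (2 * q.δ₂ + 3 * q.δ₁)
          - (q.δ₁ + q.δ₂) * h₀) * hcs
    · rw [h4, h9, h8, h7]
      linear_combination E7 - (q.δ₁ / 2 + q.δ₂) * g₂ * hcs
    · rw [h4, h9, h8, h7]
      linear_combination E8 - (q.δ₁ * h₀ + q.δ₅) * g₂ / 2 * q.δ₆ * hcs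
        - q.δ₂ * g₃ * (q.δ₆ * c - 12) * hcs

end DHCoeffs

/-! ### Classification of the solutions -/

lemma simplePoleForm_eq (L : PeriodPair) (c h₀ A B t₀ : ℂ) :
    simplePoleForm L c h₀ A B t₀ = fun t ↦ -c * L.addQuotient A B (t - t₀) + h₀ := by
  funext t
  rw [simplePoleForm, PeriodPair.addQuotient, ← mul_div_assoc, neg_mul]

namespace PeriodPair

variable (L : PeriodPair)

/-- Every point of the Weierstrass cubic is of the form `(℘ u, ℘' u)`. -/
lemma exists_weierstrassP_eq_derivWeierstrassP_eq {A B : ℂ}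
    (hB : B ^ 2 = 4 * A ^ 3 - L.g₂ * A - L.g₃) :
    ∃ u ∉ L.lattice, L.weierstrassP u = A ∧ L.derivWeierstrassP u = B := by
  obtain ⟨u, hu, rfl⟩ := L.exists_weierstrassP_eq A
  have h := L.derivWeierstrassP_sq u hu
  rw [← hB] at h
  rcases sq_eq_sq_iff_eq_or_eq_neg.1 h with h | h
  · exact ⟨u, hu, rfl, h⟩
  · exact ⟨-u, by rwa [L.neg_mem_lattice_iff], by simp, by simp [h]⟩

/-- The form with simple poles is an elliptic function of order two with simple poles. -/
lemma isEllipticOfOrder_simplePoleForm {A B : ℂ} (hB : B ^ 2 = 4 * A ^ 3 - L.g₂ * A - L.g₃) {c : ℂ}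
    (hc : c ≠ 0) (h₀ t₀ : ℂ) : IsEllipticOfOrder L 2 (simplePoleForm L c h₀ A B t₀) ∧
      ∀ z, poleMultiplicity (simplePoleForm L c h₀ A B t₀) z ≤ 1 := by
  obtain ⟨u, hu, rfl, rfl⟩ := L.exists_weierstrassP_eq_derivWeierstrassP_eq hB
  rw [simplePoleForm_eq]
  refine ⟨L.isEllipticOfOrder_addQuotient hu (neg_ne_zero.2 hc) h₀ t₀, fun z ↦ ?_⟩
  obtain ⟨h1, h2⟩ := L.poleMultiplicity_addQuotient hu (neg_ne_zero.2 hc) h₀ t₀ z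
  by_cases h : z - t₀ ∈ L.lattice ∨ z - (t₀ + u) ∈ L.lattice
  · exact (h1 h).le
  · rw [not_or] at h
    exact (h2 h.1 h.2).le.trans zero_le_one

end PeriodPair

lemma SimplePoleParams.cubic {q : DHCoeffs} {c h₀ A B g₂ g₃ : ℂ}
    (h : SimplePoleParams q c h₀ A B g₂ g₃) : B ^ 2 = 4 * A ^ 3 - g₂ * A - g₃ := by
  linear_combination h.1.2.2.2.2.1

lemma SimplePoleParams.ne_zero {q : DHCoeffs} {c h₀ A B g₂ g₃ : ℂ}
    (h : SimplePoleParams q c h₀ A B g₂ g₃) : c ≠ 0 := by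
  rintro rfl
  have h1 := h.1.2.1
  rw [eq_div_iff h.1.1] at h1
  norm_num at h1

lemma DoublePoleParams.ne_zero {q : DHCoeffs} {c h₀ g₂ g₃ : ℂ}
    (h : DoublePoleParams q c h₀ g₂ g₃) : c ≠ 0 := by
  rw [h.1.2.2.2.1]
  simp [h.1.2.2.1]

namespace DHCoeffs

variable {p : DHCoeffs} (L : PeriodPair)

/-- The solutions with simple poles, for parameters in one of the five families. -/
theorem isSolution_simplePoleForm (hγ : p.γ₁ ≠ 0) {c h₀ A B : ℂ}
    (h : SimplePoleParams p.normalize c h₀ A B L.g₂ L.g₃) (t₀ : ℂ) :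
    IsEllipticOfOrder L 2 (simplePoleForm L c h₀ A B t₀) ∧
      p.IsSolution (simplePoleForm L c h₀ A B t₀) ∧
      ∀ z, poleMultiplicity (simplePoleForm L c h₀ A B t₀) z ≤ 1 := by
  obtain ⟨h1, h2⟩ := L.isEllipticOfOrder_simplePoleForm h.cubic h.ne_zero h₀ t₀
  refine ⟨h1, ?_, h2⟩
  rw [← p.isSolution_normalize hγ, PeriodPair.isSolution_addQuotient_iff h.cubic _ rfl h.ne_zero h₀ t₀
    (simplePoleForm_eq L c h₀ A B t₀).eventuallyEq, simplePoleEquations_iff h.cubic]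
  exact h

/-- The solutions with a double pole, for parameters in one of the five families. -/
theorem isSolution_doublePoleForm (hγ : p.γ₁ ≠ 0) {c h₀ : ℂ}
    (h : DoublePoleParams p.normalize c h₀ L.g₂ L.g₃) (t₀ : ℂ) :
    IsEllipticOfOrder L 2 (doublePoleForm L c h₀ t₀) ∧
      p.IsSolution (doublePoleForm L c h₀ t₀) ∧
      2 ≤ poleMultiplicity (doublePoleForm L c h₀ t₀) t₀ := by
  refine ⟨L.isEllipticOfOrder_weierstrassP h.ne_zero h₀ t₀, ?_,
    ((L.poleMultiplicity_weierstrassP h.ne_zero h₀ t₀ t₀).1 (by simp)).ge⟩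
  rw [← p.isSolution_normalize hγ, PeriodPair.isSolution_weierstrassP_iff _ rfl h.ne_zero h₀ t₀
    (w := doublePoleForm L c h₀ t₀) EventuallyEq.rfl, doublePoleEquations_iff h.ne_zero]
  exact h

/-- Classification of the solutions with simple poles. -/
theorem simplePole_classification (hγ : p.γ₁ ≠ 0) (w : ℂ → ℂ) :
    (IsEllipticOfOrder L 2 w ∧ p.IsSolution w ∧ ∀ z, poleMultiplicity w z ≤ 1) ↔
      ∃ c h₀ A B t₀ : ℂ, SimplePoleParams p.normalize c h₀ A B L.g₂ L.g₃ ∧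
        w =ᶠ[codiscrete ℂ] simplePoleForm L c h₀ A B t₀ := by
  constructor
  · rintro ⟨hw, hs, h1⟩
    obtain ⟨u, hu, k, h₀, t₀, h⟩ := hw.eq_addQuotient h1
    have hk : k ≠ 0 := by
      rintro rfl
      exact hw.not_eventuallyEq_const h₀ (by simpa using h)
    rw [← neg_neg k] at h
    have hB := L.derivWeierstrassP_sq u hu
    rw [← p.isSolution_normalize hγ, PeriodPair.isSolution_addQuotient_iff hB _ rfl
      (neg_ne_zero.2 hk) h₀ t₀ h, simplePoleEquations_iff hB] at hs
    exact ⟨-k, h₀, _, _, t₀, hs, by rwa [simplePoleForm_eq]⟩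
  · rintro ⟨c, h₀, A, B, t₀, h, hw⟩
    obtain ⟨h1, h2, h3⟩ := isSolution_simplePoleForm L hγ h t₀
    refine ⟨h1.congr hw.symm, ?_, fun z ↦ by rw [poleMultiplicity_congr hw]; exact h3 z⟩
    rw [simplePoleForm_eq] at hw
    rw [← p.isSolution_normalize hγ, PeriodPair.isSolution_addQuotient_iff h.cubic _ rfl h.ne_zero
      h₀ t₀ hw, simplePoleEquations_iff h.cubic]
    exact h

/-- Classification of the solutions with a double pole. -/
theorem doublePole_classification (hγ : p.γ₁ ≠ 0) (w : ℂ → ℂ) :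
    (IsEllipticOfOrder L 2 w ∧ p.IsSolution w ∧ ∃ z, 2 ≤ poleMultiplicity w z) ↔
      ∃ c h₀ t₀ : ℂ, DoublePoleParams p.normalize c h₀ L.g₂ L.g₃ ∧
        w =ᶠ[codiscrete ℂ] doublePoleForm L c h₀ t₀ := by
  constructor
  · rintro ⟨hw, hs, h1⟩
    obtain ⟨k, h₀, t₀, h⟩ := hw.eq_weierstrassP h1
    have hk : k ≠ 0 := by
      rintro rfl
      exact hw.not_eventuallyEq_const h₀ (by simpa using h)
    rw [← p.isSolution_normalize hγ, PeriodPair.isSolution_weierstrassP_iff _ rfl hk h₀ t₀ h,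
      doublePoleEquations_iff hk] at hs
    exact ⟨k, h₀, t₀, hs, h⟩
  · rintro ⟨c, h₀, t₀, h, hw⟩
    obtain ⟨h1, h2, h3⟩ := isSolution_doublePoleForm L hγ h t₀
    refine ⟨h1.congr hw.symm, ?_, t₀, by rwa [poleMultiplicity_congr hw]⟩
    rw [← p.isSolution_normalize hγ, PeriodPair.isSolution_weierstrassP_iff _ rfl h.ne_zero
      h₀ t₀ hw, doublePoleEquations_iff h.ne_zero]
    exact h

end DHCoeffs

/-! ### Lattices with prescribed invariants -/

section ModularForms

open UpperHalfPlane ModularForm SlashInvariantForm ModularFormClass MatrixGroups EisensteinSeries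

/-- The limit at the cusp is the constant coefficient of the `q`-expansion. -/
lemma ModularForm.tendsto_E_atImInfty {k : ℕ} (hk : 3 ≤ k) (hk2 : Even k) :
    Tendsto (E hk) atImInfty (𝓝 1) := by
  have hanal := ModularFormClass.analyticAt_cuspFunction_zero (E hk) one_pos one_mem_strictPeriods_SL
  have h0 : cuspFunction 1 (E hk) 0 = 1 := by
    simpa [qExpansion_coeff] using E_qExpansion_coeff_zero hk hk2
  rw [← h0]
  exact (hanal.continuousAt.tendsto.comp (qParam_tendsto_atImInfty one_pos)).congr
    fun τ ↦ SlashInvariantFormClass.eq_cuspFunction (E hk) τ one_mem_strictPeriods_SL one_ne_zero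

/-- The modular function `E₄³ / Δ` is surjective. -/
theorem ModularForm.exists_E₄_cube_eq (j : ℂ) : ∃ τ : ℍ, E₄ τ ^ 3 = j * discriminant τ := by
  by_contra! hne
  set F : ModularForm 𝒮ℒ 12 :=
    mcast (by norm_num) (E₄.pow 3) - j • (CuspForm.discriminant : ModularForm 𝒮ℒ 12) with hF
  have hFz (z : ℍ) : F z = E₄ z ^ 3 - j * discriminant z := rfl
  have hF0 (z : ℍ) : F z ≠ 0 := by rw [hFz]; exact sub_ne_zero.2 (hne z)
  have hF1 : Tendsto F atImInfty (𝓝 1) := by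
    have h := ((tendsto_E_atImInfty (by norm_num : 3 ≤ 4) ⟨2, rfl⟩).pow 3).sub
      (discriminant_isZeroAtImInfty.const_mul j)
    rw [one_pow, mul_zero, sub_zero] at h
    exact h
  have hq : Tendsto (fun z ↦ discriminant z / F z) atImInfty (𝓝 0) := by
    have h := Tendsto.div discriminant_isZeroAtImInfty hF1 one_ne_zero
    rw [zero_div] at h
    exact h
  have hslash (γ : SL(2, ℤ)) : (fun z ↦ discriminant z / F z) ∣[(0 : ℤ)] γ =
      fun z ↦ discriminant z / F z := by
    have hγ : (γ : GL (Fin 2) ℝ) ∈ 𝒮ℒ := ⟨γ, rfl⟩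
    change (⇑CuspForm.discriminant / ⇑F) ∣[(12 - 12 : ℤ)] γ = ⇑CuspForm.discriminant / ⇑F
    simp_rw [div_slash_SL2, SL_slash, slash_action_eqn _ _ hγ]
  -- Without zeros of `F`, the quotient `Δ / F` is holomorphic of weight zero and bounded at the
  -- cusps, hence constant. Its limit `0` at the cusp contradicts the nonvanishing of `Δ`.
  let Q : ModularForm 𝒮ℒ 0 :=
    { toFun z := discriminant z / F z
      slash_action_eq' := fun _ ⟨γ, hγ⟩ ↦ hγ ▸ hslash γ
      holo' := CuspForm.discriminant.holo'.div F.holo' hF0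
      bdd_at_cusps' {c} hc := by
        rw [Subgroup.IsArithmetic.isCusp_iff_isCusp_SL2Z] at hc
        rw [OnePoint.isBoundedAt_iff_forall_SL2Z hc]
        intro γ _
        rw [hslash γ]
        exact hq.isBigO_one ℝ }
  obtain ⟨c, hc⟩ := levelOne_weight_zero_const Q
  have hQ : (fun z ↦ discriminant z / F z) = fun _ ↦ c := hc
  rw [hQ] at hq
  have hc0 : c = 0 := tendsto_nhds_unique tendsto_const_nhds hq
  have := congrFun hQ I
  simp [hc0, discriminant_ne_zero, hF0] at this

end ModularForms

namespace PeriodPair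

open UpperHalfPlane ModularForm EisensteinSeries in
/-- The lattice `a (ℤ τ + ℤ)` has the expected lattice sums. -/
lemma exists_G_eq (τ : ℍ) {a : ℂ} (ha : a ≠ 0) : ∃ L : PeriodPair, ∀ (k : ℕ) (hk : 3 ≤ k),
    L.G k = (a ^ k)⁻¹ * (2 * riemannZeta k * E hk τ) := by
  have hind : LinearIndependent ℝ ![a * τ, a] := by
    rw [LinearIndependent.pair_iff]
    intro s t h
    have h1 : (s : ℂ) * τ + t = 0 := mul_left_cancel₀ ha (by
      simp only [Complex.real_smul] at h
      linear_combination h)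
    have hs : s = 0 := by simpa [τ.im_ne_zero] using congrArg Complex.im h1
    exact ⟨hs, by simpa [hs] using h1⟩
  refine ⟨⟨a * τ, a, hind⟩, fun k hk ↦ ?_⟩
  set L : PeriodPair := ⟨a * τ, a, hind⟩ with hL
  -- The full lattice sum is `ζ(k)` times the sum over coprime pairs, and `E` is half of the latter.
  have h1 := tsum_eisSummand_eq_riemannZeta_mul_eisensteinSeries hk τ
  have h2 : 2 * E hk τ = eisensteinSeries (N := 1) 0 k τ := by
    change 2 * ((1 / 2 : ℂ) * eisensteinSeries (N := 1) 0 k τ) = _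
    ring
  rw [mul_right_comm, h2, mul_comm (eisensteinSeries _ _ _), ← h1, ← tsum_mul_left,
    PeriodPair.G, ← L.latticeEquivProd.symm.toEquiv.tsum_eq,
    ← (finTwoArrowEquiv ℤ).tsum_eq]
  refine tsum_congr fun v ↦ ?_
  have h3 := L.latticeEquiv_symm_apply (finTwoArrowEquiv ℤ v)
  simp only [LinearEquiv.coe_toEquiv, h3]
  have h4 : (finTwoArrowEquiv ℤ v).1 = v 0 ∧ (finTwoArrowEquiv ℤ v).2 = v 1 := ⟨rfl, rfl⟩
  simp only [eisSummand, zpow_neg, zpow_natCast, ← mul_inv, ← mul_pow, hL, h4]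
  congr 2
  ring

end PeriodPair

/-- A complex number whose square and cube are prescribed up to a common condition. -/
lemma exists_sq_mul_eq_cube_mul_eq {a b x y : ℂ} (h : a ^ 3 * y ^ 2 = x ^ 3 * b ^ 2)
    (hab : a ^ 3 - 27 * b ^ 2 ≠ 0) (hxy : x ^ 3 - 27 * y ^ 2 ≠ 0) :
    ∃ m : ℂ, m ≠ 0 ∧ m ^ 2 * a = x ∧ m ^ 3 * b = y := by
  by_cases ha : a = 0
  · have hb : b ≠ 0 := by rintro rfl; simp [ha] at hab
    have hx : x = 0 := by simpa [ha, hb] using h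
    have hy : y ≠ 0 := by rintro rfl; simp [hx] at hxy
    obtain ⟨m, hm⟩ := IsAlgClosed.exists_pow_nat_eq (y / b) (n := 3) (by norm_num)
    refine ⟨m, ?_, by simp [ha, hx], by rw [hm]; field_simp⟩
    rintro rfl
    simp [eq_comm, hy, hb] at hm
  by_cases hb : b = 0
  · have hy : y = 0 := by simpa [ha, hb] using h
    have hx : x ≠ 0 := by rintro rfl; simp [hy] at hxy
    obtain ⟨m, hm⟩ := IsAlgClosed.exists_pow_nat_eq (x / a) (n := 2) (by norm_num)
    refine ⟨m, ?_, by rw [hm]; field_simp, by simp [hb, hy]⟩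
    rintro rfl
    simp [eq_comm, hx, ha] at hm
  have hx : x ≠ 0 := by
    rintro rfl
    obtain rfl : y = 0 := by simpa [ha] using h
    simp at hxy
  have hy : y ≠ 0 := by
    rintro rfl
    simp [hx, hb] at h
  -- The witness is forced: `m = m³ / m² = (y / b) / (x / a)`.
  refine ⟨y * a / (b * x), by simp [ha, hb, hx, hy], ?_, ?_⟩
  · field_simp
    linear_combination h
  · field_simp
    linear_combination h

open UpperHalfPlane ModularForm in
/-- Every cubic `4 X³ - g₂ X - g₃` without multiple roots comes from a lattice. -/
theorem PeriodPair.exists_g₂_eq_g₃_eq {g₂ g₃ : ℂ} (h : g₂ ^ 3 - 27 * g₃ ^ 2 ≠ 0) :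
    ∃ L : PeriodPair, L.g₂ = g₂ ∧ L.g₃ = g₃ := by
  -- The prescribed value is the `j`-invariant of the cubic.
  obtain ⟨τ, hτ⟩ := ModularForm.exists_E₄_cube_eq (1728 * g₂ ^ 3 / (g₂ ^ 3 - 27 * g₃ ^ 2))
  have hΔ := discriminant_ne_zero τ
  rw [discriminant_eq_E₄_cube_sub_E₆_sq] at hτ hΔ
  have hπ : (Real.pi : ℂ) ≠ 0 := mod_cast Real.pi_ne_zero
  have h4 : riemannZeta (4 : ℕ) = Real.pi ^ 4 / 90 := by exact_mod_cast riemannZeta_four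
  have h6 : riemannZeta (6 : ℕ) = Real.pi ^ 6 / 945 := by
    have := riemannZeta_two_mul_nat (k := 3) (by norm_num)
    rw [show bernoulli (2 * 3) = 1 / 42 by decide +kernel] at this
    norm_num [Nat.factorial] at this ⊢
    rw [this]
    ring
  -- Here `a` and `b` are the invariants of `ℤ τ + ℤ`: `60 · 2ζ(4) = 4π⁴/3` and `140 · 2ζ(6) =
  -- 8π⁶/27`.
  obtain ⟨m, hm, hm2, hm3⟩ := exists_sq_mul_eq_cube_mul_eq (x := g₂) (y := g₃)
    (a := 4 / 3 * Real.pi ^ 4 * E₄ τ) (b := 8 / 27 * Real.pi ^ 6 * E₆ τ) (by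
      field_simp at hτ
      linear_combination (-64 / 729 * Real.pi ^ 12) * hτ) (by
      intro h0
      refine hΔ ?_
      have : (64 / 27 * Real.pi ^ 12 : ℂ) * (E₄ τ ^ 3 - E₆ τ ^ 2) = 0 := by linear_combination h0
      simp only [mul_eq_zero, pow_eq_zero_iff, ne_eq, OfNat.ofNat_ne_zero, not_false_eq_true, hπ,
        or_false] at this
      rw [this.resolve_left (by norm_num), zero_div]) h
  -- Scaling the lattice by `a` multiplies `g₂` by `a⁻⁴ = m²` and `g₃` by `a⁻⁶ = m³`.
  obtain ⟨a, ha⟩ := IsAlgClosed.exists_pow_nat_eq m⁻¹ (n := 2) (by norm_num)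
  have ha0 : a ≠ 0 := by rintro rfl; simp [eq_comm, hm] at ha
  obtain ⟨L, hL⟩ := exists_G_eq τ ha0
  refine ⟨L, ?_, ?_⟩
  · rw [PeriodPair.g₂, hL 4 (by norm_num), h4, show a ^ 4 = (a ^ 2) ^ 2 by ring, ha, inv_pow, inv_inv,
      ← hm2]
    ring
  · rw [PeriodPair.g₃, hL 6 (by norm_num), h6, show a ^ 6 = (a ^ 2) ^ 3 by ring, ha, inv_pow, inv_inv,
      ← hm3]
    ring

end

theorem mainTheorem3 (p : DHCoeffs) (hγ : p.γ₁ ≠ 0) :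
    (∀ (L : PeriodPair) (w : ℂ → ℂ),
      ((IsEllipticOfOrder L 2 w ∧ p.IsSolution w ∧ ∀ z, poleMultiplicity w z ≤ 1) ↔
        ∃ c h₀ A B t₀ : ℂ, SimplePoleParams p.normalize c h₀ A B L.g₂ L.g₃ ∧
          w =ᶠ[codiscrete ℂ] simplePoleForm L c h₀ A B t₀) ∧
      ((IsEllipticOfOrder L 2 w ∧ p.IsSolution w ∧ ∃ z, 2 ≤ poleMultiplicity w z) ↔
        ∃ c h₀ t₀ : ℂ, DoublePoleParams p.normalize c h₀ L.g₂ L.g₃ ∧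
          w =ᶠ[codiscrete ℂ] doublePoleForm L c h₀ t₀)) ∧
    (∀ c h₀ A B g₂ g₃ : ℂ, SimplePoleParams p.normalize c h₀ A B g₂ g₃ →
      g₂ ^ 3 - 27 * g₃ ^ 2 ≠ 0 →
      ∃ L : PeriodPair, L.g₂ = g₂ ∧ L.g₃ = g₃ ∧ ∀ t₀ : ℂ,
        IsEllipticOfOrder L 2 (simplePoleForm L c h₀ A B t₀) ∧
          p.IsSolution (simplePoleForm L c h₀ A B t₀)) ∧
    (∀ c h₀ g₂ g₃ : ℂ, DoublePoleParams p.normalize c h₀ g₂ g₃ →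
      g₂ ^ 3 - 27 * g₃ ^ 2 ≠ 0 →
      ∃ L : PeriodPair, L.g₂ = g₂ ∧ L.g₃ = g₃ ∧ ∀ t₀ : ℂ,
        IsEllipticOfOrder L 2 (doublePoleForm L c h₀ t₀) ∧
          p.IsSolution (doublePoleForm L c h₀ t₀)) := by
  refine ⟨fun L w ↦ ⟨DHCoeffs.simplePole_classification L hγ w,
    DHCoeffs.doublePole_classification L hγ w⟩, ?_, ?_⟩
  · intro c h₀ A B g₂ g₃ hp h
    obtain ⟨L, rfl, rfl⟩ := PeriodPair.exists_g₂_eq_g₃_eq h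
    exact ⟨L, rfl, rfl, fun t₀ ↦ (DHCoeffs.isSolution_simplePoleForm L hγ hp t₀).imp_right And.left⟩
  · intro c h₀ g₂ g₃ hp h
    obtain ⟨L, rfl, rfl⟩ := PeriodPair.exists_g₂_eq_g₃_eq h
    exact ⟨L, rfl, rfl, fun t₀ ↦ (DHCoeffs.isSolution_doublePoleForm L hγ hp t₀).imp_right And.left⟩
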